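/- Let $F$ be a field of characteristic different from $2$ (for example a prime field $\mathbb F_p$, $p\neq 2$), let $a,d\in F$ be nonzero with $a\ne d$, and let $E$ be the twisted Edwards curve $ax^2+y^2=1+dx^2y^2$, with neutral element $\mathcal O=(0,1)$, negation $-(x,y)=(-x,y)$, and the usual (Edwards) addition law. Put $\mathcal O'=(0,-1)$, and let $\Omega_1=(1:0:0)$ and $\Omega_2=(0:1:0)$ be the two singular points at infinity of the projective plane curve $aX^2Z^2+Y^2Z^2=Z^4+dX^2Y^2$. Points and divisors are taken on the smooth projective model of $E$ (the closure of the affine curve in $\mathbb P^1\times\mathbb P^1$), divisors over an algebraically closed field $K\supseteq F$; there $2(\Omega_1)$, respectively $2(\Omega_2)$, denotes the sum of the two points over $\Omega_1$, respectively $\Omega_2$. For $F$-rational points $R,P$ let $\phi_{R,P}\in F[X,Y,Z]$ be a nonzero quadratic form whose conic passes through $R$, $P$, $\mathcal O'$, $\Omega_1$ and $\Omega_2$, coinciding points being counted with multiplicity: at every point $Q$ of the model it meets the curve with multiplicity at least the coefficient of $(Q)$ in $(R)+(P)+(\mathcal O')+2(\Omega_1)+2(\Omega_2)$. Such a form exists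 and is unique up to a nonzero constant in $F$, and the rational function $\phi_{R,P}(x,y,1)$ has divisor $$(R)+(P)+(-[R+P])+(\mathcal O')-2(\Omega_1)-2(\Omega_2).$$ Moreover the function $$g_{R,P}=\frac{\phi_{R,P}}{\phi_{R+P,\,-[R+P]}}$$ satisfies $$\operatorname{div}(g_{R,P})=(R)+(P)-(R+P)-(\mathcal O),$$ that is, $g_{R,P}$ is a Miller function for $R$ and $P$. -/

import Mathlib

open Polynomial

/-- The parameters of a twisted Edwards curve `a x² + y² = 1 + d x² y²` over a field `F` of
characteristic different from `2`, with `a` and `d` nonzero and distinct. -/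
structure TwistedEdwards (F : Type*) [Field F] where
  a : F
  d : F
  two_ne_zero : (2 : F) ≠ 0
  a_ne_zero : a ≠ 0
  d_ne_zero : d ≠ 0
  a_ne_d : a ≠ d

namespace TwistedEdwards

section ProjectiveLine

/-- The point of the projective line `F ∪ {∞}` with homogeneous coordinates `(X : Z)`. -/
noncomputable def ofHom {F : Type*} [Field F] (X Z : F) : OnePoint F :=
  open Classical in if Z = 0 then OnePoint.infty else OnePoint.some (X / Z)

/-- First homogeneous coordinate of a point of the projective line. -/
def hNum {F : Type*} [Field F] : OnePoint F → F
  | OnePoint.infty => 1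
  | OnePoint.some c => c

/-- Second homogeneous coordinate of a point of the projective line. -/
def hDen {F : Type*} [Field F] : OnePoint F → F
  | OnePoint.infty => 0
  | OnePoint.some _ => 1

@[simp] lemma hNum_infty {F : Type*} [Field F] : hNum (OnePoint.infty : OnePoint F) = 1 := rfl

@[simp] lemma hNum_some {F : Type*} [Field F] (c : F) : hNum (OnePoint.some c) = c := rfl

@[simp] lemma hDen_infty {F : Type*} [Field F] : hDen (OnePoint.infty : OnePoint F) = 0 := rfl

@[simp] lemma hDen_some {F : Type*} [Field F] (c : F) : hDen (OnePoint.some c) = 1 := rfl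

lemma exists_ofHom {F : Type*} [Field F] {X Z : F} (h : ¬ (X = 0 ∧ Z = 0)) :
    ∃ c : F, c ≠ 0 ∧ X = c * hNum (ofHom X Z) ∧ Z = c * hDen (ofHom X Z) := by
  by_cases hZ : Z = 0
  · refine ⟨X, fun hX => h ⟨hX, hZ⟩, ?_, ?_⟩ <;> simp [ofHom, hZ]
  · refine ⟨Z, hZ, ?_, ?_⟩
    · simp only [ofHom, hZ, if_false, hNum_some]
      field_simp
    · simp [ofHom, hZ]

end ProjectiveLine

section Points

variable {F : Type*} [Field F]

/-- The bihomogeneous equation of the curve in `ℙ¹ × ℙ¹`, at `((X : Z), (Y : T))`. -/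
def Equation (E : TwistedEdwards F) (X Z Y T : F) : Prop :=
  E.a * X ^ 2 * T ^ 2 + Y ^ 2 * Z ^ 2 = Z ^ 2 * T ^ 2 + E.d * X ^ 2 * Y ^ 2

/-- An `F`-rational point of the smooth projective model of the curve, which is its closure in
`ℙ¹ × ℙ¹`. Besides the affine solutions `(x, y)` there are the points `(∞, y)` with `d y² = a`,
which lie over the node `Ω₁ = (1 : 0 : 0)` of the plane curve, and the points `(x, ∞)` with
`d x² = 1`, which lie over the node `Ω₂ = (0 : 1 : 0)`. -/
@[ext]
structure Point (E : TwistedEdwards F) where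
  x : OnePoint F
  y : OnePoint F
  eqn : E.Equation (hNum x) (hDen x) (hNum y) (hDen y)

namespace Point

variable {E : TwistedEdwards F}

/-- The affine point `(x, y)`. -/
def affine (x y : F) (h : E.a * x ^ 2 + y ^ 2 = 1 + E.d * x ^ 2 * y ^ 2) : E.Point where
  x := OnePoint.some x
  y := OnePoint.some y
  eqn := by simpa [Equation] using h

/-- `1` at the points that lie over `Ω₁` or `Ω₂`, and `0` at the affine points. -/
noncomputable def atInfinity (Q : E.Point) : ℤ :=
  open Classical in if Q.x = OnePoint.infty ∨ Q.y = OnePoint.infty then 1 else 0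

/-- The neutral element `O = (0, 1)`. -/
instance : Zero E.Point := ⟨affine 0 1 (by simp)⟩

/-- The point `O' = (0, -1)`. -/
def O' : E.Point := affine 0 (-1) (by simp)

/-- The negative `-(x, y) = (-x, y)`, with `-∞ = ∞`. -/
instance : Neg E.Point where
  neg P :=
    { x := OnePoint.map (fun c => -c) P.x
      y := P.y
      eqn := by
        obtain ⟨x, y, h⟩ := P
        cases x using OnePoint.rec <;> simpa [Equation] using h }

section Addition

variable (P Q : E.Point)

/-- Numerator of `x = (x₁ y₂ + x₂ y₁) / (1 + d x₁ x₂ y₁ y₂)`, in homogeneous coordinates. -/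
def sumX : F := hNum P.x * hNum Q.y * hDen Q.x * hDen P.y
  + hNum Q.x * hNum P.y * hDen P.x * hDen Q.y

/-- Denominator of `x = (x₁ y₂ + x₂ y₁) / (1 + d x₁ x₂ y₁ y₂)`. -/
def sumZ : F := hDen P.x * hDen Q.x * hDen P.y * hDen Q.y
  + E.d * hNum P.x * hNum Q.x * hNum P.y * hNum Q.y

/-- Numerator of `y = (y₁ y₂ - a x₁ x₂) / (1 - d x₁ x₂ y₁ y₂)`. -/
def sumY : F := hNum P.y * hNum Q.y * hDen P.x * hDen Q.x
  - E.a * hNum P.x * hNum Q.x * hDen P.y * hDen Q.y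

/-- Denominator of `y = (y₁ y₂ - a x₁ x₂) / (1 - d x₁ x₂ y₁ y₂)`. -/
def sumT : F := hDen P.x * hDen Q.x * hDen P.y * hDen Q.y
  - E.d * hNum P.x * hNum Q.x * hNum P.y * hNum Q.y

/-- Numerator of `x = (x₁ y₁ + x₂ y₂) / (a x₁ x₂ + y₁ y₂)`, in homogeneous coordinates. -/
def dualX : F := hNum P.x * hNum P.y * hDen Q.x * hDen Q.y
  + hNum Q.x * hNum Q.y * hDen P.x * hDen P.y

/-- Denominator of `x = (x₁ y₁ + x₂ y₂) / (a x₁ x₂ + y₁ y₂)`. -/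
def dualZ : F := E.a * hNum P.x * hNum Q.x * hDen P.y * hDen Q.y
  + hNum P.y * hNum Q.y * hDen P.x * hDen Q.x

/-- Numerator of `y = (x₁ y₁ - x₂ y₂) / (x₁ y₂ - x₂ y₁)`. -/
def dualY : F := hNum P.x * hNum P.y * hDen Q.x * hDen Q.y
  - hNum Q.x * hNum Q.y * hDen P.x * hDen P.y

/-- Denominator of `y = (x₁ y₁ - x₂ y₂) / (x₁ y₂ - x₂ y₁)`. -/
def dualT : F := hNum P.x * hNum Q.y * hDen Q.x * hDen P.y
  - hNum Q.x * hNum P.y * hDen P.x * hDen Q.y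

/-- The Edwards addition law gives a well-defined point of `ℙ¹ × ℙ¹`. -/
def SumDefined : Prop :=
  ¬ (P.sumX Q = 0 ∧ P.sumZ Q = 0) ∧ ¬ (P.sumY Q = 0 ∧ P.sumT Q = 0)

/-- The dual addition law gives a well-defined point of `ℙ¹ × ℙ¹`. -/
def DualDefined : Prop :=
  ¬ (P.dualX Q = 0 ∧ P.dualZ Q = 0) ∧ ¬ (P.dualY Q = 0 ∧ P.dualT Q = 0)

lemma equation_sum : E.Equation (P.sumX Q) (P.sumZ Q) (P.sumY Q) (P.sumT Q) := by
  have h₁ := P.eqn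
  have h₂ := Q.eqn
  simp only [Equation, sumX, sumZ, sumY, sumT] at *
  generalize hNum P.x = X1 at *
  generalize hDen P.x = Z1 at *
  generalize hNum P.y = Y1 at *
  generalize hDen P.y = T1 at *
  generalize hNum Q.x = X2 at *
  generalize hDen Q.x = Z2 at *
  generalize hNum Q.y = Y2 at *
  generalize hDen Q.y = T2 at *
  generalize E.a = a at *
  generalize E.d = d at *
  linear_combination (-Y1^2*Z1^2*Y2^2*Z2^2*X2^2*T2^2*d + Y1^2*X1^2*Y2^4*Z2^2*X2^2*d^2 -
      Y1^2*X1^2*Y2^2*Z2^2*X2^2*T2^2*d^2 + Y1^2*X1^2*Y2^2*X2^4*T2^2*a*d^2 +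
      Z1^2*T1^2*Y2^2*Z2^4*T2^2 - Z1^2*T1^2*Y2^2*Z2^2*X2^2*T2^2*d + Z1^2*T1^2*Z2^2*X2^2*T2^4*a
      - X1^2*T1^2*Y2^4*Z2^4*d + X1^2*T1^2*Y2^4*Z2^2*X2^2*d^2 + X1^2*T1^2*Y2^2*Z2^4*T2^2*d -
      3*X1^2*T1^2*Y2^2*Z2^2*X2^2*T2^2*a*d + X1^2*T1^2*Y2^2*X2^4*T2^2*a*d^2 +
      X1^2*T1^2*Z2^2*X2^2*T2^4*a*d - X1^2*T1^2*X2^4*T2^4*a^2*d) * h₁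
      + (Y1^4*X1^4*Y2^2*X2^2*d^3 - Y1^2*X1^4*T1^2*Y2^2*Z2^2*d^2 - Y1^2*X1^4*T1^2*X2^2*T2^2*a*d^2
      + Z1^4*T1^4*Z2^2*T2^2 - Z1^2*X1^2*T1^4*Y2^2*Z2^2*d - Z1^2*X1^2*T1^4*X2^2*T2^2*a*d +
      X1^4*T1^4*Y2^2*Z2^2*a*d + X1^4*T1^4*X2^2*T2^2*a^2*d) * h₂

lemma equation_dual : E.Equation (P.dualX Q) (P.dualZ Q) (P.dualY Q) (P.dualT Q) := by
  have h₁ := P.eqn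
  have h₂ := Q.eqn
  simp only [Equation, dualX, dualZ, dualY, dualT] at *
  generalize hNum P.x = X1 at *
  generalize hDen P.x = Z1 at *
  generalize hNum P.y = Y1 at *
  generalize hDen P.y = T1 at *
  generalize hNum Q.x = X2 at *
  generalize hDen Q.x = Z2 at *
  generalize hNum Q.y = Y2 at *
  generalize hDen Q.y = T2 at *
  generalize E.a = a at *
  generalize E.d = d at *
  linear_combination (-Y1^2*Z1^2*Y2^2*Z2^2*X2^2*T2^2 + Y1^2*X1^2*Y2^2*Z2^4*T2^2 -
      Y1^2*X1^2*Y2^2*Z2^2*X2^2*T2^2*d + Y1^2*X1^2*Z2^2*X2^2*T2^4*a + Z1^2*T1^2*Y2^4*Z2^2*X2^2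
      - Z1^2*T1^2*Y2^2*Z2^2*X2^2*T2^2 + Z1^2*T1^2*Y2^2*X2^4*T2^2*a - X1^2*T1^2*Y2^4*Z2^4 +
      X1^2*T1^2*Y2^4*Z2^2*X2^2*d + X1^2*T1^2*Y2^2*Z2^4*T2^2 -
      3*X1^2*T1^2*Y2^2*Z2^2*X2^2*T2^2*a + X1^2*T1^2*Y2^2*X2^4*T2^2*a*d +
      X1^2*T1^2*Z2^2*X2^2*T2^4*a - X1^2*T1^2*X2^4*T2^4*a^2) * h₁
      + (Y1^4*X1^4*Z2^2*T2^2*d - Y1^2*X1^4*T1^2*Y2^2*Z2^2*d - Y1^2*X1^4*T1^2*X2^2*T2^2*a*d +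
      Z1^4*T1^4*Y2^2*X2^2 - Z1^2*X1^2*T1^4*Y2^2*Z2^2 - Z1^2*X1^2*T1^4*X2^2*T2^2*a +
      X1^4*T1^4*Y2^2*Z2^2*a + X1^4*T1^4*X2^2*T2^2*a^2) * h₂

lemma dualDefined_of_not_sumDefined (h : ¬ P.SumDefined Q) : P.DualDefined Q := by
  obtain ⟨x₁, y₁, h₁⟩ := P
  obtain ⟨x₂, y₂, h₂⟩ := Q
  have ha := E.a_ne_zero
  have hd := E.d_ne_zero
  have had := E.a_ne_d
  have h2 := E.two_ne_zero
  by_contra h'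
  rw [SumDefined, not_and_or, not_not, not_not] at h
  rw [DualDefined, not_and_or, not_not, not_not] at h'
  simp only [sumX, sumZ, sumY, sumT, dualX, dualZ, dualY, dualT, Equation] at h h' h₁ h₂
  rcases h with h | h <;> rcases h' with h' | h' <;> obtain ⟨e₁, e₂⟩ := h <;>
    obtain ⟨e₃, e₄⟩ := h' <;>
    cases x₁ using OnePoint.rec <;> cases y₁ using OnePoint.rec <;>
    cases x₂ using OnePoint.rec <;> cases y₂ using OnePoint.rec <;>
    simp only [hNum_infty, hNum_some, hDen_infty, hDen_some] at * <;> grind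

lemma equation_ofHom {X Z Y T : F} (hE : E.Equation X Z Y T) (h : ¬ (X = 0 ∧ Z = 0))
    (h' : ¬ (Y = 0 ∧ T = 0)) :
    E.Equation (hNum (ofHom X Z)) (hDen (ofHom X Z)) (hNum (ofHom Y T)) (hDen (ofHom Y T)) := by
  obtain ⟨c, hc, hX, hZ⟩ := exists_ofHom h
  obtain ⟨e, he, hY, hT⟩ := exists_ofHom h'
  generalize hNum (ofHom X Z) = X' at *
  generalize hDen (ofHom X Z) = Z' at *
  generalize hNum (ofHom Y T) = Y' at *
  generalize hDen (ofHom Y T) = T' at *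
  subst hX hZ hY hT
  simp only [Equation] at *
  have : c ^ 2 * e ^ 2 ≠ 0 := by positivity
  apply mul_left_cancel₀ this
  linear_combination hE

/-- The group law of the curve. The Edwards addition law is used wherever it is defined. At the
remaining pairs of points (which exist only if `d` or `a d` is a square) it is replaced by the
dual addition law, which computes the same sum wherever both are defined. -/
noncomputable instance : Add E.Point where
  add P Q := open Classical in
    if h : P.SumDefined Q then
      { x := ofHom (P.sumX Q) (P.sumZ Q)
        y := ofHom (P.sumY Q) (P.sumT Q)
        eqn := equation_ofHom (P.equation_sum Q) h.1 h.2 }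
    else
      { x := ofHom (P.dualX Q) (P.dualZ Q)
        y := ofHom (P.dualY Q) (P.dualT Q)
        eqn := equation_ofHom (P.equation_dual Q) (P.dualDefined_of_not_sumDefined Q h).1
          (P.dualDefined_of_not_sumDefined Q h).2 }

end Addition

end Point

end Points

section BaseChange

variable {F : Type*} [Field F] (K : Type*) [Field K] [Algebra F K]

/-- The same curve over an extension field `K`. -/
def baseChange (E : TwistedEdwards F) : TwistedEdwards K where
  a := algebraMap F K E.a
  d := algebraMap F K E.d
  two_ne_zero := by
    have h := (_root_.map_ne_zero (algebraMap F K)).mpr E.two_ne_zero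
    simpa only [map_ofNat] using h
  a_ne_zero := (_root_.map_ne_zero _).mpr E.a_ne_zero
  d_ne_zero := (_root_.map_ne_zero _).mpr E.d_ne_zero
  a_ne_d := fun h => E.a_ne_d ((algebraMap F K).injective h)

lemma hNum_map (c : OnePoint F) :
    hNum (OnePoint.map (algebraMap F K) c) = algebraMap F K (hNum c) := by
  cases c using OnePoint.rec <;> simp

lemma hDen_map (c : OnePoint F) :
    hDen (OnePoint.map (algebraMap F K) c) = algebraMap F K (hDen c) := by
  cases c using OnePoint.rec <;> simp

/-- An `F`-rational point, regarded as a point over an extension field `K`. -/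
def Point.baseChange {E : TwistedEdwards F} (P : E.Point) : (E.baseChange K).Point where
  x := OnePoint.map (algebraMap F K) P.x
  y := OnePoint.map (algebraMap F K) P.y
  eqn := by
    have h := congrArg (algebraMap F K) P.eqn
    simpa only [Equation, TwistedEdwards.baseChange, hNum_map, hDen_map, map_add, map_mul,
      map_pow] using h

end BaseChange

section FunctionField

variable {K : Type*} [Field K] (E : TwistedEdwards K)

/-- The polynomial `a X² + Y² - (1 + d X² Y²)` in `K[X][Y]`. -/
noncomputable def polynomial : K[X][X] :=
  C (C E.a * X ^ 2) + X ^ 2 - (1 + C (C E.d * X ^ 2) * X ^ 2)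

lemma polynomial_eq : E.polynomial =
    C (1 - C E.d * X ^ 2) * X ^ 2 + C 0 * X + C (C E.a * X ^ 2 - 1) := by
  simp only [polynomial, map_sub, map_one, map_zero]
  ring

lemma not_sq (s : K[X]) : s ^ 2 ≠ (1 - C E.d * X ^ 2) * (1 - C E.a * X ^ 2) := by
  intro h
  have e : (1 - C E.d * X ^ 2) * (1 - C E.a * X ^ 2) =
      C (E.d * E.a) * X ^ 4 + C 0 * X ^ 3 + C (-(E.a + E.d)) * X ^ 2 + C 0 * X + C 1 := by
    simp only [map_mul, map_neg, map_add, map_zero, map_one]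
    ring
  rw [e] at h
  have hda : E.d * E.a ≠ 0 := mul_ne_zero E.d_ne_zero E.a_ne_zero
  have hdeg := congrArg natDegree h
  have h4 : (C (E.d * E.a) * X ^ 4 + C 0 * X ^ 3 + C (-(E.a + E.d)) * X ^ 2 + C 0 * X
      + C 1 : K[X]).natDegree = 4 := by
    compute_degree!
    exact ⟨E.d_ne_zero, E.a_ne_zero⟩
  rw [natDegree_pow, h4] at hdeg
  have hs : s.natDegree ≤ 2 := by omega
  rw [s.as_sum_range_C_mul_X_pow' (Nat.lt_succ_of_le hs)] at h
  simp only [Finset.sum_range_succ, Finset.sum_range_zero] at h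
  generalize s.coeff 0 = s₀ at h
  generalize s.coeff 1 = s₁ at h
  generalize s.coeff 2 = s₂ at h
  have h' : C (s₂ ^ 2) * X ^ 4 + C (2 * s₁ * s₂) * X ^ 3 + C (s₁ ^ 2 + 2 * s₀ * s₂) * X ^ 2
      + C (2 * s₀ * s₁) * X + C (s₀ ^ 2) = C (E.d * E.a) * X ^ 4 + C 0 * X ^ 3
      + C (-(E.a + E.d)) * X ^ 2 + C 0 * X + C 1 := by
    rw [← h]
    simp only [map_mul, map_add, map_pow, map_ofNat]
    ring
  have c4 := congrArg (fun p => coeff p 4) h'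
  have c3 := congrArg (fun p => coeff p 3) h'
  have c2 := congrArg (fun p => coeff p 2) h'
  have c0 := congrArg (fun p => coeff p 0) h'
  simp only [coeff_add, coeff_C_mul, coeff_X_pow, coeff_X, coeff_C] at c4 c3 c2 c0
  norm_num at c4 c3 c2 c0
  have h2 := E.two_ne_zero
  have had := E.a_ne_d
  clear h h' e h4 hdeg hs
  grind

lemma prime_polynomial : Prime E.polynomial := by
  rw [← irreducible_iff_prime]
  have hlead : (1 - C E.d * X ^ 2 : K[X]) ≠ 0 := by
    intro h
    have := congrArg (fun p => coeff p 0) h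
    simp at this
  have hdeg : E.polynomial.natDegree = 2 := by
    rw [polynomial_eq]
    exact natDegree_quadratic hlead
  have h0 : E.polynomial ≠ 0 := by
    intro h
    rw [h] at hdeg
    simp at hdeg
  have c0 : E.polynomial.coeff 0 = C E.a * X ^ 2 - 1 := by
    rw [polynomial_eq]; simp only [coeff_add, coeff_C_mul, coeff_X_pow, coeff_X, coeff_C]; norm_num
  have c1 : E.polynomial.coeff 1 = 0 := by
    rw [polynomial_eq]; simp only [coeff_add, coeff_C_mul, coeff_X_pow, coeff_X, coeff_C]; norm_num
  have c2 : E.polynomial.coeff 2 = 1 - C E.d * X ^ 2 := by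
    rw [polynomial_eq]; simp only [coeff_add, coeff_C_mul, coeff_X_pow, coeff_X, coeff_C]; norm_num
  have key : ∀ f g : K[X][X], E.polynomial = f * g → f.natDegree = 0 → IsUnit f := by
    intro f g hfg hf
    rw [eq_C_of_natDegree_eq_zero hf] at hfg ⊢
    generalize f.coeff 0 = u at hfg ⊢
    have d0 : u ∣ C E.a * X ^ 2 - 1 := ⟨g.coeff 0, by rw [← c0, hfg, coeff_C_mul]⟩
    have d2 : u ∣ 1 - C E.d * X ^ 2 := ⟨g.coeff 2, by rw [← c2, hfg, coeff_C_mul]⟩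
    have d3 : u ∣ C (E.a - E.d) := by
      have := (d0.mul_left (C E.d)).add (d2.mul_left (C E.a))
      refine this.trans (dvd_of_eq ?_)
      simp only [map_sub]
      ring
    exact (isUnit_of_dvd_unit d3
      (isUnit_C.mpr (sub_ne_zero.mpr E.a_ne_d).isUnit)).map (C : K[X] →+* K[X][X])
  refine ⟨fun h => ?_, fun f g hfg => ?_⟩
  · have := natDegree_eq_zero_of_isUnit h
    omega
  · have hf0 : f ≠ 0 := by rintro rfl; simp at hfg; exact h0 hfg
    have hg0 : g ≠ 0 := by rintro rfl; simp at hfg; exact h0 hfg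
    have hd : f.natDegree + g.natDegree = 2 := by rw [← natDegree_mul hf0 hg0, ← hfg, hdeg]
    by_cases hf : f.natDegree = 0
    · exact Or.inl (key f g hfg hf)
    by_cases hg : g.natDegree = 0
    · exact Or.inr (key g f (by rw [hfg, mul_comm]) hg)
    exfalso
    have hf1 : f.natDegree ≤ 1 := by omega
    have hg1 : g.natDegree ≤ 1 := by omega
    rw [eq_X_add_C_of_natDegree_le_one hf1, eq_X_add_C_of_natDegree_le_one hg1] at hfg
    generalize f.coeff 1 = f₁ at hfg
    generalize f.coeff 0 = f₀ at hfg
    generalize g.coeff 1 = g₁ at hfg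
    generalize g.coeff 0 = g₀ at hfg
    have hfg' : E.polynomial = C (f₁ * g₁) * X ^ 2 + C (f₁ * g₀ + f₀ * g₁) * X
        + C (f₀ * g₀) := by
      rw [hfg]
      simp only [map_mul, map_add]
      ring
    rw [hfg'] at c0 c1 c2
    simp only [coeff_add, coeff_C_mul, coeff_X_pow, coeff_X, coeff_C] at c0 c1 c2
    norm_num at c0 c1 c2
    apply E.not_sq (f₁ * g₀)
    linear_combination (f₁ * g₀) * c1 - f₁ * g₁ * c0 - (C E.a * X ^ 2 - 1) * c2

/-- The affine coordinate ring `K[x, y] / (a x² + y² - 1 - d x² y²)`. -/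
abbrev CoordinateRing : Type _ := AdjoinRoot E.polynomial

instance : IsDomain E.CoordinateRing :=
  AdjoinRoot.isDomain_of_prime E.prime_polynomial

/-- The field of rational functions on the curve. -/
abbrev FunctionField : Type _ := FractionRing E.CoordinateRing

/-- The coordinate function `x`. -/
noncomputable def x : E.FunctionField :=
  algebraMap E.CoordinateRing E.FunctionField (AdjoinRoot.of E.polynomial X)

/-- The coordinate function `y`. -/
noncomputable def y : E.FunctionField :=
  algebraMap E.CoordinateRing E.FunctionField (AdjoinRoot.root E.polynomial)

variable {E}

/-- The local coordinate of the projective line at the point `c` that vanishes at `c`, evaluated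
at the function `z`: it is `z - c` if `c` is finite, and `1 / z` if `c = ∞`. -/
noncomputable def localCoord (z : E.FunctionField) : OnePoint K → E.FunctionField
  | OnePoint.infty => z⁻¹
  | OnePoint.some c => z - algebraMap K E.FunctionField c

namespace Point

variable (Q : E.Point)

/-- The two coordinates, centred at `Q`, of the affine chart of `ℙ¹ × ℙ¹` around `Q`. -/
noncomputable def localCoords : Fin 2 → E.FunctionField :=
  ![localCoord E.x Q.x, localCoord E.y Q.y]

/-- The local ring of the curve at `Q`: the rational functions `p / q` with `p` and `q`
polynomials in the local coordinates and `q(Q) ≠ 0`. -/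
noncomputable def localRing : Subring E.FunctionField where
  carrier := {f | ∃ p q : MvPolynomial (Fin 2) K, MvPolynomial.constantCoeff q ≠ 0 ∧
    MvPolynomial.aeval Q.localCoords q ≠ 0 ∧
    f = MvPolynomial.aeval Q.localCoords p / MvPolynomial.aeval Q.localCoords q}
  zero_mem' := ⟨0, 1, by simp, by simp, by simp⟩
  one_mem' := ⟨1, 1, by simp, by simp, by simp⟩
  add_mem' := by
    rintro _ _ ⟨p, q, h, h', rfl⟩ ⟨r, s, k, k', rfl⟩
    refine ⟨p * s + q * r, q * s, ?_, ?_, ?_⟩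
    · simpa using ⟨h, k⟩
    · simpa using ⟨h', k'⟩
    · simp only [map_add, map_mul]
      exact div_add_div _ _ h' k'
  mul_mem' := by
    rintro _ _ ⟨p, q, h, h', rfl⟩ ⟨r, s, k, k', rfl⟩
    refine ⟨p * r, q * s, ?_, ?_, ?_⟩
    · simpa using ⟨h, k⟩
    · simpa using ⟨h', k'⟩
    · simp only [map_mul]
      exact div_mul_div_comm _ _ _ _
  neg_mem' := by
    rintro _ ⟨p, q, h, h', rfl⟩
    exact ⟨-p, q, h, h', by simp [neg_div]⟩

/-- `u` is a unit of the local ring at `Q`. -/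
def IsUnitAt (u : E.FunctionField) : Prop :=
  u ≠ 0 ∧ u ∈ Q.localRing ∧ u⁻¹ ∈ Q.localRing

/-- `t` is a uniformizer at `Q`: a non-unit of the local ring that divides every non-unit of it
(the convention `0⁻¹ = 0` makes `t ≠ 0`). -/
def IsUniformizerAt (t : E.FunctionField) : Prop :=
  t ∈ Q.localRing ∧ t⁻¹ ∉ Q.localRing ∧
    ∀ f ∈ Q.localRing, f⁻¹ ∉ Q.localRing → f / t ∈ Q.localRing

/-- The rational function `f` is nonzero and `ord_Q(f) = n`, that is, `f = tⁿ u` with a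
uniformizer `t` at `Q` and a unit `u` of the local ring at `Q`. -/
def HasOrderAt (f : E.FunctionField) (n : ℤ) : Prop :=
  ∃ t u, Q.IsUniformizerAt t ∧ Q.IsUnitAt u ∧ f = t ^ n * u

lemma IsUniformizerAt.ne_zero {t : E.FunctionField} (ht : Q.IsUniformizerAt t) : t ≠ 0 := by
  rintro rfl
  exact ht.2.1 (by simp)

lemma IsUniformizerAt.isUnitAt_div {t s : E.FunctionField} (ht : Q.IsUniformizerAt t)
    (hs : Q.IsUniformizerAt s) : Q.IsUnitAt (s / t) :=
  ⟨div_ne_zero hs.ne_zero ht.ne_zero, ht.2.2 s hs.1 hs.2.1,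
    by rw [inv_div]; exact hs.2.2 t ht.1 ht.2.1⟩

/-- The order of a rational function at a point is unique. -/
lemma HasOrderAt.unique {f : E.FunctionField} {m n : ℤ} (hm : Q.HasOrderAt f m)
    (hn : Q.HasOrderAt f n) : m = n := by
  have hpow : ∀ (u : E.FunctionField), Q.IsUnitAt u → ∀ k : ℤ, u ^ k ∈ Q.localRing := by
    intro u hu k
    cases k with
    | ofNat k => simpa using Q.localRing.pow_mem hu.2.1 k
    | negSucc k =>
      rw [zpow_negSucc, ← inv_pow]
      exact Q.localRing.pow_mem hu.2.2 _
  have key : ∀ m n : ℤ, Q.HasOrderAt f m → Q.HasOrderAt f n → ¬ m < n := by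
    rintro m n ⟨t, u, ht, hu, rfl⟩ ⟨s, v, hs, hv, h⟩ hlt
    have ht0 := ht.ne_zero
    have hs0 := hs.ne_zero
    have hu0 := hu.1
    apply ht.2.1
    obtain ⟨k, hk⟩ : ∃ k : ℕ, n = m + 1 + k := ⟨(n - m - 1).toNat, by omega⟩
    have e : t⁻¹ = t ^ k * (s / t) ^ n * v * u⁻¹ := by
      have h' : u = t ^ (-m) * (s ^ n * v) := by
        rw [← h, ← mul_assoc, ← zpow_add₀ ht0]; simp
      have h'' : t ^ k * (s / t) ^ n * v = t⁻¹ * u := by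
        rw [h', div_zpow, ← zpow_natCast, show (k : ℤ) = n + (-m) + (-1) by omega,
          zpow_add₀ ht0, zpow_add₀ ht0, zpow_neg_one]
        field_simp
      rw [h'']
      field_simp
    rw [e]
    exact Q.localRing.mul_mem (Q.localRing.mul_mem (Q.localRing.mul_mem
      (Q.localRing.pow_mem ht.1 k) (hpow _ (ht.isUnitAt_div Q hs) n)) hv.2.1) hu.2.2
  exact le_antisymm (not_lt.mp (key n m hn hm)) (not_lt.mp (key m n hm hn))

/-- Homogeneous coordinates `(X : Y : Z)` of the generic point `(x : y : 1)` of the plane curve,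
scaled so that they are regular at `Q` and do not all vanish there: `(x : y : 1)` at affine points,
`(1 : y / x : 1 / x)` over `Ω₁`, and `(x / y : 1 : 1 / y)` over `Ω₂`. -/
noncomputable def planeCoords : Fin 3 → E.FunctionField :=
  match Q.x, Q.y with
  | OnePoint.some _, OnePoint.some _ => ![E.x, E.y, 1]
  | OnePoint.infty, _ => ![1, E.y / E.x, E.x⁻¹]
  | OnePoint.some _, OnePoint.infty => ![E.x / E.y, 1, E.y⁻¹]

end Point

/-- The divisor `(Q)` of a point `Q`. Divisors are finite formal sums of points with integer
coefficients. -/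
noncomputable def Point.toDivisor (Q : E.Point) : E.Point →₀ ℤ := Finsupp.single Q 1

/-- `D` is the divisor of the rational function `f`: for every point `Q` of the curve the order of
`f` at `Q` is the coefficient of `Q` in `D`. -/
def IsDivisor (f : E.FunctionField) (D : E.Point →₀ ℤ) : Prop :=
  ∀ Q : E.Point, Q.HasOrderAt f (D Q)

end FunctionField

section Conics

variable {F : Type*} [Field F] {E : TwistedEdwards F} (K : Type*) [Field K] [Algebra F K]

/-- The rational function `φ(x, y, 1)` given by a form `φ(X, Y, Z)`. -/
noncomputable def formFunction (E : TwistedEdwards F) (φ : MvPolynomial (Fin 3) F) :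
    (E.baseChange K).FunctionField :=
  MvPolynomial.aeval ![(E.baseChange K).x, (E.baseChange K).y, 1]
    (MvPolynomial.map (algebraMap F K) φ)

/-- The curve `φ = 0` and the Edwards curve meet with multiplicity at least `n` at `Q` (on the
branch of the plane curve given by `Q`, if `Q` lies over `Ω₁` or `Ω₂`). -/
def MeetsAt {E : TwistedEdwards K} (φ : MvPolynomial (Fin 3) K) (Q : E.Point) (n : ℤ) : Prop :=
  ∃ m : ℤ, n ≤ m ∧ Q.HasOrderAt (MvPolynomial.aeval Q.planeCoords φ) m

/-- `φ` is the equation, over `F`, of a conic that passes through `R`, `P`, `O' = (0, -1)` and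
through the two nodes `Ω₁`, `Ω₂`, where points that coincide are counted with multiplicity: at
each geometric point `Q` of the curve the conic meets the curve with multiplicity at least the
number of times that `Q` occurs among `R`, `P`, `O'` and the points over `Ω₁` and `Ω₂`. -/
def IsConicThrough (φ : MvPolynomial (Fin 3) F) (R P : E.Point) : Prop :=
  φ ≠ 0 ∧ φ.IsHomogeneous 2 ∧ ∀ Q : (E.baseChange K).Point,
    MeetsAt K (MvPolynomial.map (algebraMap F K) φ) Q
      (((R.baseChange K).toDivisor + (P.baseChange K).toDivisor + Point.O'.toDivisor :
        (E.baseChange K).Point →₀ ℤ) Q + Q.atInfinity)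

/-- A Miller function for `R` and `P`: a rational function with divisor
`(R) + (P) - (R + P) - (O)`. -/
def IsMillerFunction (g : (E.baseChange K).FunctionField) (R P : E.Point) : Prop :=
  IsDivisor g ((R.baseChange K).toDivisor + (P.baseChange K).toDivisor
    - ((R + P).baseChange K).toDivisor - Point.toDivisor 0)

end Conics

end TwistedEdwards

/-!
Because of the two nodes and of `O'`, a conic as in the theorem has an equation
`A (Z² + Y Z) + B X Z + D X Y = 0` (`IsConicThrough.exists_eq`). On the smooth model in `ℙ¹ × ℙ¹`,
with coordinates `((X : Z), (Y : T))`, this is the `(1, 1)`-form `A (Y + T) Z + X (B T + D Y)`, and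
the passage from the plane to `ℙ¹ × ℙ¹` removes exactly the multiplicities at the nodes
(`aeval_planeCoords`, `formFunction_conicForm`).

The main step, `Point.exists_divisor`, is that every such conic has divisor
`(S₁) + (S₂) + (S₃) + (O')` with `S₁ + S₂ + S₃ = O`. If `A = 0` or `B = D`, the conic is a pair of
lines and its divisor is known. Otherwise its product with the conjugate form
`A (Y + T) Z - X (B T + D Y)` is, on the curve and up to factors without zeros at the points of the
conic where `x` is neither `0` nor `∞`, the binary form
`A² (Y + T) (a T² - d Y²) - (T - Y) (B T + D Y)²` of degree three. Its roots are the second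
coordinates of the `Sᵢ`, and Vieta's formulas for them imply the two addition laws
(`cubic_relations`). Being identities between coefficients, they hold for multiple roots as well,
so that tangency needs no separate treatment. The multiplicity of a root is the order of the conic
where `y` is a local parameter. The remaining points, `O'` and those with `x = ∞`, are treated
directly.

If the conic passes through `R` and `P`, these are two of the `Sᵢ`, and the third one is `-(R + P)`
(`Point.hasOrderAt_conicAt`). Two conics with the same divisor are proportional, as the combination
of their equations that vanishes at a further point has too many zeros
(`Point.exists_proportional`). Over `F` the conic exists by linear algebra if `R`, `P` and `O'` are
distinct, and by the formula for the tangent conic or as a pair of lines if not. In the quotient of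
the conics for `R`, `P` and for `R + P`, `-(R + P)`, the points `O'` and `-(R + P)` and the nodes
cancel, which leaves `(R) + (P) - (R + P) - (O)`.

Orders are accessible because in every chart the curve is a twisted Edwards curve again
(`exists_chart`). So regular functions have well-defined values, and the equation in the chart
exhibits one of the centred coordinates as a uniformizer (`Point.hasOrderAt_localCoord`).
-/

namespace TwistedEdwards

/-! ### Evaluation of rational functions at points -/

section Evaluation

variable {K : Type*} [Field K] (E : TwistedEdwards K)

/-- The `K`-algebra homomorphism out of the coordinate ring that sends the coordinates to a given
solution `(s, t)` of the curve equation. -/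
noncomputable def liftPoint {S : Type*} [CommRing S] [Algebra K S] (s t : S)
    (h : algebraMap K S E.a * s ^ 2 + t ^ 2 = 1 + algebraMap K S E.d * s ^ 2 * t ^ 2) :
    E.CoordinateRing →ₐ[K] S :=
  AdjoinRoot.liftAlgHom E.polynomial (aeval s) t (by
    simp only [polynomial, eval₂_sub, eval₂_add, eval₂_mul, eval₂_pow, eval₂_C, eval₂_X, eval₂_one,
      RingHom.coe_coe, map_mul, map_pow, aeval_C, aeval_X]
    linear_combination h)

@[simp] lemma liftPoint_of {S : Type*} [CommRing S] [Algebra K S] (s t : S)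
    (h : algebraMap K S E.a * s ^ 2 + t ^ 2 = 1 + algebraMap K S E.d * s ^ 2 * t ^ 2) (p : K[X]) :
    E.liftPoint s t h (AdjoinRoot.of E.polynomial p) = aeval s p := by
  simp [liftPoint]

@[simp] lemma liftPoint_root {S : Type*} [CommRing S] [Algebra K S] (s t : S)
    (h : algebraMap K S E.a * s ^ 2 + t ^ 2 = 1 + algebraMap K S E.d * s ^ 2 * t ^ 2) :
    E.liftPoint s t h (AdjoinRoot.root E.polynomial) = t := by
  simp [liftPoint]

lemma natDegree_polynomial : E.polynomial.natDegree = 2 := by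
  rw [polynomial_eq]
  refine natDegree_quadratic fun h => ?_
  simpa using congrArg (fun p => coeff p 0) h

lemma root_equation : AdjoinRoot.of E.polynomial (C E.a * X ^ 2) + AdjoinRoot.root E.polynomial ^ 2
    = 1 + AdjoinRoot.of E.polynomial (C E.d * X ^ 2) * AdjoinRoot.root E.polynomial ^ 2 := by
  have h : AdjoinRoot.mk E.polynomial
      (C (C E.a * X ^ 2) + X ^ 2 - (1 + C (C E.d * X ^ 2) * X ^ 2)) = 0 := AdjoinRoot.mk_self
  simp only [map_sub, map_add, map_mul (AdjoinRoot.mk _), map_pow (AdjoinRoot.mk _),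
    AdjoinRoot.mk_C, AdjoinRoot.mk_X, map_one] at h
  linear_combination h

/-- The equation of the curve in its function field. -/
lemma generic_equation : algebraMap K E.FunctionField E.a * E.x ^ 2 + E.y ^ 2
    = 1 + algebraMap K E.FunctionField E.d * E.x ^ 2 * E.y ^ 2 := by
  have h := congrArg (algebraMap E.CoordinateRing E.FunctionField) E.root_equation
  simpa [x, y, IsScalarTower.algebraMap_apply K E.CoordinateRing E.FunctionField,
    AdjoinRoot.algebraMap_eq'] using h

lemma of_injective : Function.Injective (AdjoinRoot.of E.polynomial) := by
  rw [injective_iff_map_eq_zero]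
  intro p hp
  have h : E.polynomial ∣ C p := by
    rw [← AdjoinRoot.mk_eq_zero, AdjoinRoot.mk_C, hp]
  by_contra h0
  have := natDegree_le_of_dvd h (by simpa using h0)
  rw [natDegree_polynomial, natDegree_C] at this
  omega

lemma isAlgebraic_coordinateRing (f : E.CoordinateRing) : IsAlgebraic K[X] f := by
  have hr : IsAlgebraic K[X] (AdjoinRoot.root E.polynomial) :=
    ⟨E.polynomial, E.prime_polynomial.ne_zero, by
      rw [AdjoinRoot.aeval_eq, AdjoinRoot.mk_self]⟩
  have h := Algebra.isAlgebraic_adjoin_singleton_iff.mpr hr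
  rw [AdjoinRoot.adjoinRoot_eq_top] at h
  exact h f trivial

/-- The curve is one-dimensional: a homomorphism from its coordinate ring to a field is injective
as soon as the image of the coordinate `x` is transcendental. -/
lemma injective_of_transcendental {L : Type*} [Field L] [Algebra K L]
    (θ : E.CoordinateRing →ₐ[K] L) (h : Transcendental K (θ (AdjoinRoot.of E.polynomial X))) :
    Function.Injective θ := by
  rw [injective_iff_map_eq_zero]
  intro f hf
  by_contra hf0
  apply Ideal.comap_ne_bot_of_algebraic_mem (R := K[X]) (I := RingHom.ker θ) hf0 hf
    (E.isAlgebraic_coordinateRing f)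
  rw [eq_bot_iff]
  intro p hp
  have hp' : θ (AdjoinRoot.of E.polynomial p) = 0 := hp
  rw [transcendental_iff] at h
  refine h p ?_
  have e : (aeval (θ (AdjoinRoot.of E.polynomial X))) p = θ (AdjoinRoot.of E.polynomial p) := by
    simpa using aeval_algHom_apply (θ.comp (IsScalarTower.toAlgHom K K[X] E.CoordinateRing)) X p
  rw [e, hp']

lemma transcendental_x : Transcendental K E.x := by
  rw [transcendental_iff]
  intro p hp
  apply E.of_injective
  apply IsFractionRing.injective E.CoordinateRing E.FunctionField
  rw [map_zero, map_zero, ← hp]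
  simpa [x] using (aeval_algHom_apply
    ((IsScalarTower.toAlgHom K E.CoordinateRing E.FunctionField).comp
      (IsScalarTower.toAlgHom K K[X] E.CoordinateRing)) X p).symm

lemma x_ne_zero : E.x ≠ 0 := by
  intro h
  exact E.transcendental_x (h ▸ isAlgebraic_zero)

lemma y_ne_zero : E.y ≠ 0 := by
  intro h
  have e := E.generic_equation
  rw [h] at e
  refine E.transcendental_x ⟨C E.a * X ^ 2 - 1, fun h0 => ?_, ?_⟩
  · simpa using congrArg (fun p => coeff p 0) h0
  · simp only [map_sub, map_mul, aeval_C, map_pow, aeval_X, map_one]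
    linear_combination e

/-- In each of the three charts of `ℙ¹ × ℙ¹` that meet the curve, the curve is again a twisted
Edwards curve, and `Q` becomes a point `(s, t)` of its affine part. The map `θ` is the resulting
embedding of coordinate rings. -/
lemma exists_chart {E : TwistedEdwards K} (Q : E.Point) :
    ∃ (E' : TwistedEdwards K) (θ : E'.CoordinateRing →ₐ[K] E.FunctionField)
      (ev : E'.CoordinateRing →ₐ[K] K) (b : Fin 2 → E'.CoordinateRing),
      Function.Injective θ ∧ (∀ i, θ (b i) = Q.localCoords i) ∧ ∀ i, ev (b i) = 0 := by
  obtain ⟨x₀, y₀, h⟩ := Q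
  have hx := E.x_ne_zero
  have hy := E.y_ne_zero
  have hE := E.generic_equation
  have hT := E.transcendental_x
  have ha := E.a_ne_zero
  have hd := E.d_ne_zero
  cases x₀ using OnePoint.rec with
  | infty =>
    cases y₀ using OnePoint.rec with
    | infty => simp [Equation, hd.symm] at h
    | coe y₀ =>
      simp only [Equation, hNum_infty, hDen_infty, hNum_some, hDen_some] at h
      have hy₀ : y₀ ≠ 0 := by rintro rfl; simp [ha] at h
      let E' : TwistedEdwards K := ⟨E.a⁻¹, E.d⁻¹, E.two_ne_zero, inv_ne_zero ha, inv_ne_zero hd,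
        fun h => E.a_ne_d (inv_injective h)⟩
      have hy₀' : algebraMap K E.FunctionField y₀ ≠ 0 := by simpa using hy₀
      have ha' : algebraMap K E.FunctionField E.a ≠ 0 := by simpa using ha
      have hd' : algebraMap K E.FunctionField E.d ≠ 0 := by simpa using hd
      have h' := congrArg (algebraMap K E.FunctionField) h
      simp only [map_add, map_mul, map_pow, map_one, map_zero] at h'
      refine ⟨E', E'.liftPoint E.x⁻¹ (E.y / algebraMap K _ y₀) ?_, E'.liftPoint 0 1 ?_,
        ![AdjoinRoot.of _ X, algebraMap K _ y₀ * (AdjoinRoot.root _ - 1)], ?_, ?_, ?_⟩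
      · simp only [E', map_inv₀]
        field_simp
        generalize algebraMap K E.FunctionField y₀ = t at *
        generalize algebraMap K E.FunctionField E.a = a at *
        generalize algebraMap K E.FunctionField E.d = d at *
        generalize E.x = x at *
        generalize E.y = y at *
        have : a = d * t ^ 2 := by linear_combination h'
        subst this
        linear_combination -d * t ^ 2 * hE
      · simp
      · apply injective_of_transcendental
        rw [liftPoint_of, aeval_X]
        exact fun h => hT (by simpa using IsAlgebraic.inv h)
      · intro i
        fin_cases i
        · simp [Point.localCoords, localCoord]
        · simp only [Point.localCoords, localCoord, Fin.mk_one, Matrix.cons_val_one,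
            Matrix.cons_val_fin_one, map_mul, map_sub, AlgHom.commutes, liftPoint_root, map_one]
          field_simp
      · intro i
        fin_cases i <;> simp
  | coe x₀ =>
    cases y₀ using OnePoint.rec with
    | infty =>
      simp only [Equation, hNum_infty, hDen_infty, hNum_some, hDen_some] at h
      let E' : TwistedEdwards K := ⟨E.d, E.a, E.two_ne_zero, hd, ha, E.a_ne_d.symm⟩
      refine ⟨E', E'.liftPoint E.x E.y⁻¹ ?_, E'.liftPoint x₀ 0 ?_,
        ![AdjoinRoot.of _ (X - C x₀), AdjoinRoot.root _], ?_, ?_, ?_⟩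
      · simp only [E']
        field_simp
        linear_combination -hE
      · simp only [E', Algebra.algebraMap_self, RingHom.id_apply]
        linear_combination -h
      · apply injective_of_transcendental
        simpa using hT
      · intro i
        fin_cases i <;> simp [Point.localCoords, localCoord]
      · intro i
        fin_cases i <;> simp
    | coe y₀ =>
      simp only [Equation, hNum_some, hDen_some] at h
      refine ⟨E, E.liftPoint E.x E.y hE, E.liftPoint x₀ y₀ ?_,
        ![AdjoinRoot.of _ (X - C x₀), AdjoinRoot.root _ - algebraMap K _ y₀], ?_, ?_, ?_⟩
      · simp only [Algebra.algebraMap_self, RingHom.id_apply]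
        linear_combination h
      · apply injective_of_transcendental
        simpa using hT
      · intro i
        fin_cases i <;> simp [Point.localCoords, localCoord]
      · intro i
        fin_cases i <;> simp

/-- Evaluation at `Q` is well defined: a polynomial in the local coordinates that vanishes as a
rational function vanishes at `Q`. -/
lemma constantCoeff_eq_zero {E : TwistedEdwards K} (Q : E.Point) {p : MvPolynomial (Fin 2) K}
    (h : MvPolynomial.aeval Q.localCoords p = 0) : MvPolynomial.constantCoeff p = 0 := by
  obtain ⟨E', θ, ev, b, hθ, hb, hev⟩ := exists_chart Q
  have h₁ : θ (MvPolynomial.aeval b p) = 0 := by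
    rw [← h, MvPolynomial.comp_aeval_apply]
    congr 2
    funext i
    exact hb i
  have h₂ : ev (MvPolynomial.aeval b p) = 0 := by
    rw [hθ (h₁.trans (map_zero θ).symm), map_zero]
  rw [MvPolynomial.comp_aeval_apply, funext hev, MvPolynomial.aeval_zero'] at h₂
  exact h₂

end Evaluation

/-! ### Values of regular functions -/

namespace Point

section Values

variable {K : Type*} [Field K] {E : TwistedEdwards K} (Q : E.Point)

/-- `f` is regular at `Q` with value `v` there. -/
def HasValue (f : E.FunctionField) (v : K) : Prop :=
  ∃ p q : MvPolynomial (Fin 2) K, MvPolynomial.constantCoeff q ≠ 0 ∧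
    f = MvPolynomial.aeval Q.localCoords p / MvPolynomial.aeval Q.localCoords q ∧
    v = MvPolynomial.constantCoeff p / MvPolynomial.constantCoeff q

variable {Q}

lemma aeval_ne_zero {q : MvPolynomial (Fin 2) K} (h : MvPolynomial.constantCoeff q ≠ 0) :
    MvPolynomial.aeval Q.localCoords q ≠ 0 :=
  fun h' => h (constantCoeff_eq_zero Q h')

lemma HasValue.mem {f : E.FunctionField} {v : K} (h : Q.HasValue f v) : f ∈ Q.localRing := by
  obtain ⟨p, q, hq, rfl, -⟩ := h
  exact ⟨p, q, hq, aeval_ne_zero hq, rfl⟩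

lemma exists_hasValue {f : E.FunctionField} (h : f ∈ Q.localRing) : ∃ v, Q.HasValue f v := by
  obtain ⟨p, q, hq, -, rfl⟩ := h
  exact ⟨_, p, q, hq, rfl, rfl⟩

variable (Q) in
lemma hasValue_algebraMap (c : K) : Q.HasValue (algebraMap K _ c) c :=
  ⟨MvPolynomial.C c, 1, by simp, by simp, by simp⟩

variable (Q) in
lemma hasValue_one : Q.HasValue 1 1 := by simpa using Q.hasValue_algebraMap 1

variable (Q) in
lemma hasValue_localCoords (i : Fin 2) : Q.HasValue (Q.localCoords i) 0 :=
  ⟨MvPolynomial.X i, 1, by simp, by simp, by simp⟩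

lemma HasValue.add {f g : E.FunctionField} {v w : K} (hf : Q.HasValue f v) (hg : Q.HasValue g w) :
    Q.HasValue (f + g) (v + w) := by
  obtain ⟨p, q, hq, rfl, rfl⟩ := hf
  obtain ⟨r, s, hs, rfl, rfl⟩ := hg
  refine ⟨p * s + q * r, q * s, by simp [hq, hs], ?_, ?_⟩
  · simp only [map_add, map_mul]
    exact div_add_div _ _ (aeval_ne_zero hq) (aeval_ne_zero hs)
  · simp only [map_add, map_mul]
    exact div_add_div _ _ hq hs

lemma HasValue.mul {f g : E.FunctionField} {v w : K} (hf : Q.HasValue f v) (hg : Q.HasValue g w) :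
    Q.HasValue (f * g) (v * w) := by
  obtain ⟨p, q, hq, rfl, rfl⟩ := hf
  obtain ⟨r, s, hs, rfl, rfl⟩ := hg
  refine ⟨p * r, q * s, by simp [hq, hs], ?_, ?_⟩ <;>
  · simp only [map_mul]
    exact div_mul_div_comm _ _ _ _

lemma HasValue.neg {f : E.FunctionField} {v : K} (hf : Q.HasValue f v) : Q.HasValue (-f) (-v) := by
  simpa using (Q.hasValue_algebraMap (-1)).mul hf

lemma HasValue.sub {f g : E.FunctionField} {v w : K} (hf : Q.HasValue f v) (hg : Q.HasValue g w) :
    Q.HasValue (f - g) (v - w) := by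
  simpa [sub_eq_add_neg] using hf.add hg.neg

lemma HasValue.pow {f : E.FunctionField} {v : K} (hf : Q.HasValue f v) (n : ℕ) :
    Q.HasValue (f ^ n) (v ^ n) := by
  induction n with
  | zero => simpa using Q.hasValue_one
  | succ n ih => simpa [pow_succ] using ih.mul hf

lemma HasValue.inv {f : E.FunctionField} {v : K} (hf : Q.HasValue f v) (hv : v ≠ 0) :
    Q.HasValue f⁻¹ v⁻¹ := by
  obtain ⟨p, q, hq, rfl, rfl⟩ := hf
  exact ⟨q, p, fun h => hv (by simp [h]), by simp, by simp⟩

lemma HasValue.unique {f : E.FunctionField} {v w : K} (hf : Q.HasValue f v)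
    (hg : Q.HasValue f w) : v = w := by
  have h := hf.sub hg
  rw [sub_self] at h
  obtain ⟨p, q, hq, h₀, h₁⟩ := h
  rw [eq_comm, div_eq_zero_iff, or_iff_left (aeval_ne_zero hq)] at h₀
  rwa [constantCoeff_eq_zero Q h₀, zero_div, sub_eq_zero] at h₁

lemma HasValue.isUnitAt {f : E.FunctionField} {v : K} (hf : Q.HasValue f v) (hv : v ≠ 0) :
    Q.IsUnitAt f := by
  refine ⟨?_, hf.mem, (hf.inv hv).mem⟩
  rintro rfl
  exact hv (hf.unique (by simpa using Q.hasValue_algebraMap 0))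

lemma HasValue.inv_notMem {f : E.FunctionField} (hf : Q.HasValue f 0) (h0 : f ≠ 0) :
    f⁻¹ ∉ Q.localRing := by
  intro h
  obtain ⟨w, hw⟩ := exists_hasValue h
  have := hf.mul hw
  rw [mul_inv_cancel₀ h0, zero_mul] at this
  exact one_ne_zero (Q.hasValue_one.unique this)

lemma HasValue.eq_zero {f : E.FunctionField} {v : K} (hf : Q.HasValue f v)
    (h : f⁻¹ ∉ Q.localRing) : v = 0 := by
  by_contra hv
  exact h (hf.inv hv).mem

/-- The maximal ideal of the local ring is generated by the two local coordinates, so that a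
local coordinate which divides the other one is a uniformizer. -/
lemma isUniformizerAt_of_dvd {t : E.FunctionField} (ht : Q.HasValue t 0) (h0 : t ≠ 0)
    (h : ∀ i, Q.localCoords i / t ∈ Q.localRing) : Q.IsUniformizerAt t := by
  refine ⟨ht.mem, ht.inv_notMem h0, ?_⟩
  have key : ∀ p : MvPolynomial (Fin 2) K, ∃ g ∈ Q.localRing, MvPolynomial.aeval Q.localCoords p =
      algebraMap K _ (MvPolynomial.constantCoeff p) + t * g := by
    intro p
    induction p using MvPolynomial.induction_on with
    | C a => exact ⟨0, zero_mem _, by simp⟩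
    | add p q hp hq =>
      obtain ⟨g, hg, e⟩ := hp
      obtain ⟨g', hg', e'⟩ := hq
      refine ⟨g + g', add_mem hg hg', ?_⟩
      rw [map_add, e, e', map_add, map_add]
      ring
    | mul_X p i hp =>
      refine ⟨MvPolynomial.aeval Q.localCoords p * (Q.localCoords i / t),
        mul_mem ⟨p, 1, by simp, by simp, by simp⟩ (h i), ?_⟩
      rw [map_mul, MvPolynomial.aeval_X, map_mul, MvPolynomial.constantCoeff_X, mul_zero, map_zero]
      field_simp
      ring
  rintro f hf hf'
  obtain ⟨v, hv⟩ := exists_hasValue hf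
  have hv0 := hv.eq_zero hf'
  obtain ⟨p, q, hq, rfl, hpq⟩ := hv
  rw [hv0, eq_comm, div_eq_zero_iff, or_iff_left hq] at hpq
  obtain ⟨g, hg, e⟩ := key p
  have e' : MvPolynomial.aeval Q.localCoords p / MvPolynomial.aeval Q.localCoords q / t =
      g * (1 / MvPolynomial.aeval Q.localCoords q) := by
    rw [e, hpq, map_zero, zero_add]
    field_simp
  rw [e']
  exact mul_mem hg ⟨1, q, hq, aeval_ne_zero hq, by simp⟩

end Values

end Point

/-! ### Orders of rational functions -/

lemma hNum_or_hDen {F : Type*} [Field F] (c : OnePoint F) : hNum c ≠ 0 ∨ hDen c ≠ 0 := by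
  cases c using OnePoint.rec <;> simp

lemma eq_of_cross_eq {F : Type*} [Field F] {b c : OnePoint F}
    (h : hDen c * hNum b - hNum c * hDen b = 0) : b = c := by
  cases c using OnePoint.rec <;> cases b using OnePoint.rec <;> simp_all [sub_eq_zero]

namespace Point

section Orders

variable {K : Type*} [Field K] {E : TwistedEdwards K} {Q : E.Point}

lemma IsUnitAt.mul {f g : E.FunctionField} (hf : Q.IsUnitAt f) (hg : Q.IsUnitAt g) :
    Q.IsUnitAt (f * g) :=
  ⟨mul_ne_zero hf.1 hg.1, mul_mem hf.2.1 hg.2.1, by rw [mul_inv]; exact mul_mem hf.2.2 hg.2.2⟩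

lemma IsUnitAt.inv {f : E.FunctionField} (hf : Q.IsUnitAt f) : Q.IsUnitAt f⁻¹ :=
  ⟨inv_ne_zero hf.1, hf.2.2, by rw [inv_inv]; exact hf.2.1⟩

variable (Q) in
lemma isUnitAt_one : Q.IsUnitAt 1 := Q.hasValue_one.isUnitAt one_ne_zero

lemma IsUnitAt.pow {f : E.FunctionField} (hf : Q.IsUnitAt f) (n : ℕ) : Q.IsUnitAt (f ^ n) := by
  induction n with
  | zero => simpa using Q.isUnitAt_one
  | succ n ih => simpa [pow_succ] using ih.mul hf

lemma IsUnitAt.zpow {f : E.FunctionField} (hf : Q.IsUnitAt f) (n : ℤ) : Q.IsUnitAt (f ^ n) := by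
  cases n with
  | ofNat n => simpa using hf.pow n
  | negSucc n => simpa [zpow_negSucc] using (hf.pow (n + 1)).inv

/-- The order may be computed with any uniformizer. -/
lemma HasOrderAt.exists_eq {f t : E.FunctionField} {n : ℤ} (hf : Q.HasOrderAt f n)
    (ht : Q.IsUniformizerAt t) : ∃ u, Q.IsUnitAt u ∧ f = t ^ n * u := by
  obtain ⟨s, u, hs, hu, rfl⟩ := hf
  refine ⟨(s / t) ^ n * u, ((ht.isUnitAt_div Q hs).zpow n).mul hu, ?_⟩
  have := ht.ne_zero
  rw [← mul_assoc, ← mul_zpow, mul_div_cancel₀ _ this]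

lemma HasOrderAt.ne_zero {f : E.FunctionField} {n : ℤ} (hf : Q.HasOrderAt f n) : f ≠ 0 := by
  obtain ⟨t, u, ht, hu, rfl⟩ := hf
  exact mul_ne_zero (zpow_ne_zero _ ht.ne_zero) hu.1

lemma HasOrderAt.mul {f g : E.FunctionField} {m n : ℤ} (hf : Q.HasOrderAt f m)
    (hg : Q.HasOrderAt g n) : Q.HasOrderAt (f * g) (m + n) := by
  obtain ⟨t, u, ht, hu, rfl⟩ := hf
  obtain ⟨v, hv, rfl⟩ := hg.exists_eq ht
  refine ⟨t, u * v, ht, hu.mul hv, ?_⟩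
  rw [zpow_add₀ ht.ne_zero]
  ring

lemma HasOrderAt.inv {f : E.FunctionField} {m : ℤ} (hf : Q.HasOrderAt f m) :
    Q.HasOrderAt f⁻¹ (-m) := by
  obtain ⟨t, u, ht, hu, rfl⟩ := hf
  exact ⟨t, u⁻¹, ht, hu.inv, by rw [mul_inv, zpow_neg]⟩

lemma HasOrderAt.div {f g : E.FunctionField} {m n : ℤ} (hf : Q.HasOrderAt f m)
    (hg : Q.HasOrderAt g n) : Q.HasOrderAt (f / g) (m - n) := by
  simpa [div_eq_mul_inv, sub_eq_add_neg] using hf.mul hg.inv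

lemma IsUniformizerAt.hasOrderAt {t : E.FunctionField} (ht : Q.IsUniformizerAt t) :
    Q.HasOrderAt t 1 := ⟨t, 1, ht, Q.isUnitAt_one, by simp⟩

lemma IsUniformizerAt.hasValue {t : E.FunctionField} (ht : Q.IsUniformizerAt t) :
    Q.HasValue t 0 := by
  obtain ⟨v, hv⟩ := exists_hasValue ht.1
  rwa [hv.eq_zero ht.2.1] at hv

lemma HasOrderAt.mem {f : E.FunctionField} {m : ℤ} (hf : Q.HasOrderAt f m) (hm : 0 ≤ m) :
    f ∈ Q.localRing := by
  obtain ⟨t, u, ht, hu, rfl⟩ := hf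
  obtain ⟨k, rfl⟩ := Int.eq_ofNat_of_zero_le hm
  exact mul_mem (by simpa using pow_mem ht.1 k) hu.2.1

lemma HasOrderAt.hasValue_zero {f : E.FunctionField} {m : ℤ} (hf : Q.HasOrderAt f m)
    (hm : 0 < m) : Q.HasValue f 0 := by
  obtain ⟨t, u, ht, hu, rfl⟩ := hf
  obtain ⟨k, rfl⟩ : ∃ k : ℕ, m = k + 1 := ⟨(m - 1).toNat, by omega⟩
  obtain ⟨v, hv⟩ := exists_hasValue (mul_mem (pow_mem ht.1 k) hu.2.1)
  have e : t ^ ((k : ℤ) + 1) * u = t * (t ^ k * u) := by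
    rw [zpow_add_one₀ ht.ne_zero, zpow_natCast]; ring
  rw [e]
  simpa using ht.hasValue.mul hv

lemma HasOrderAt.nonneg {f : E.FunctionField} {m : ℤ} (hf : Q.HasOrderAt f m)
    (h : f ∈ Q.localRing) : 0 ≤ m := by
  by_contra hm
  have h0 := hf.inv.hasValue_zero (by omega)
  exact h0.inv_notMem (inv_ne_zero hf.ne_zero) (by simpa using h)

/-- A nonzero function that vanishes at `Q` has positive order there. -/
lemma HasValue.one_le {f : E.FunctionField} {m : ℤ} (hv : Q.HasValue f 0)
    (hm : Q.HasOrderAt f m) : 1 ≤ m := by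
  have h0 := hm.nonneg hv.mem
  have h1 : m ≠ 0 := by
    rintro rfl
    exact hv.inv_notMem hm.ne_zero (hm.inv.mem (by omega))
  omega

/-- The order of a sum is at least the minimum of the orders. -/
lemma HasOrderAt.add_le {f g : E.FunctionField} {k l m n : ℤ} (hf : Q.HasOrderAt f k)
    (hg : Q.HasOrderAt g l) (hfg : Q.HasOrderAt (f + g) m) (hk : n ≤ k) (hl : n ≤ l) : n ≤ m := by
  obtain ⟨t, u, ht, hu, e⟩ := id hfg
  have ht0 := ht.ne_zero
  have hn : Q.HasOrderAt (t ^ n) n := ⟨t, 1, ht, Q.isUnitAt_one, by simp⟩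
  have h := add_mem ((hf.div hn).mem (by omega)) ((hg.div hn).mem (by omega))
  rw [← add_div] at h
  have := (hfg.div hn).nonneg h
  omega

end Orders

/-! ### Local coordinates -/

section Charts

variable {K : Type*} [Field K] {E : TwistedEdwards K}

/-- The order of a local coordinate `u`, read off the equation
`u (u + 2 s) A + w (w + 2 t) B = 0` of the curve in a chart centred at `(s, t)`. The coordinate
`u` is a uniformizer unless `t = 0`, where the tangent is `u = 0`. -/
lemma hasOrderAt_of_relation {Q : E.Point} {u w A B : E.FunctionField} {s t A₀ B₀ : K}
    (hcoord : ∀ i, Q.localCoords i = u ∨ Q.localCoords i = w) (hu : Q.HasValue u 0)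
    (hw : Q.HasValue w 0) (hu0 : u ≠ 0) (hw0 : w ≠ 0) (hA : Q.HasValue A A₀)
    (hB : Q.HasValue B B₀) (hA₀ : A₀ ≠ 0) (hB₀ : B₀ ≠ 0) (hst : s ≠ 0 ∨ t ≠ 0)
    (h : u * ((u + algebraMap K _ (2 * s)) * A) + w * ((w + algebraMap K _ (2 * t)) * B) = 0) :
    (t ≠ 0 → Q.IsUniformizerAt u) ∧ (t = 0 → Q.HasOrderAt u 2) := by
  have h2 := E.two_ne_zero
  have hg := (hu.add (Q.hasValue_algebraMap (2 * s))).mul hA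
  have hh := (hw.add (Q.hasValue_algebraMap (2 * t))).mul hB
  rw [zero_add] at hg hh
  generalize (u + algebraMap K _ (2 * s)) * A = g at *
  constructor
  · intro ht
    have hh0 : 2 * t * B₀ ≠ 0 := mul_ne_zero (mul_ne_zero h2 ht) hB₀
    generalize (w + algebraMap K _ (2 * t)) * B = r at *
    have hr0 := (hh.isUnitAt hh0).1
    refine isUniformizerAt_of_dvd hu hu0 fun i => ?_
    rcases hcoord i with hi | hi <;> rw [hi]
    · rw [div_self hu0]
      exact one_mem _
    · have e : w / u = -(g * r⁻¹) := by
        field_simp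
        linear_combination h
      rw [e]
      exact neg_mem (hg.mul (hh.inv hh0)).mem
  · rintro rfl
    have hg0 : 2 * s * A₀ ≠ 0 := mul_ne_zero (mul_ne_zero h2 (by simpa using hst)) hA₀
    have hg1 := (hg.isUnitAt hg0).1
    have hunit : Q.IsUnitAt (-B / g) := by
      have := (hB.neg.mul (hg.inv hg0)).isUnitAt (mul_ne_zero (neg_ne_zero.mpr hB₀)
        (inv_ne_zero hg0))
      rwa [← div_eq_mul_inv] at this
    simp only [mul_zero, map_zero, add_zero] at h
    have e : u = w ^ 2 * (-B / g) := by
      field_simp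
      linear_combination h
    refine ⟨w, _, isUniformizerAt_of_dvd hw hw0 fun i => ?_, hunit, by exact_mod_cast e⟩
    rcases hcoord i with hi | hi <;> rw [hi]
    · have e' : u / w = w * (-B / g) := by
        rw [e]
        field_simp
      rw [e']
      exact mul_mem hw.mem hunit.2.1
    · rw [div_self hw0]
      exact one_mem _

/-- The numerator of the function `z` in homogeneous coordinates `(numAt z c : denAt z c)` that are
suited to the point `c` of the projective line: `(z : 1)` if `c` is finite, and `(1 : 1 / z)` if
`c = ∞`. Where `z` takes the value `c`, they take the values `hNum c` and `hDen c`. -/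
noncomputable def numAt (z : E.FunctionField) : OnePoint K → E.FunctionField
  | OnePoint.infty => 1
  | OnePoint.some _ => z

/-- The denominator of the function `z` that belongs to the numerator `numAt z c`. -/
noncomputable def denAt (z : E.FunctionField) : OnePoint K → E.FunctionField
  | OnePoint.infty => z⁻¹
  | OnePoint.some _ => 1

@[simp] lemma numAt_infty (z : E.FunctionField) : numAt z (OnePoint.infty : OnePoint K) = 1 := rfl
@[simp] lemma numAt_some (z : E.FunctionField) (c : K) : numAt z (OnePoint.some c) = z := rfl
@[simp] lemma denAt_infty (z : E.FunctionField) : denAt z (OnePoint.infty : OnePoint K) = z⁻¹ := rfl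
@[simp] lemma denAt_some (z : E.FunctionField) (c : K) : denAt z (OnePoint.some c) = 1 := rfl

@[simp] lemma localCoord_infty (z : E.FunctionField) :
    localCoord z (OnePoint.infty : OnePoint K) = z⁻¹ := rfl
@[simp] lemma localCoord_some (z : E.FunctionField) (c : K) :
    localCoord z (OnePoint.some c) = z - algebraMap K _ c := rfl

lemma numAt_eq (z : E.FunctionField) (c : OnePoint K) : numAt z c =
    algebraMap K _ (hNum c) + algebraMap K _ (hDen c) * localCoord z c := by
  cases c using OnePoint.rec <;> simp

lemma denAt_eq (z : E.FunctionField) (c : OnePoint K) : denAt z c =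
    algebraMap K _ (hDen c) + algebraMap K _ (1 - hDen c) * localCoord z c := by
  cases c using OnePoint.rec <;> simp

variable (Q : E.Point)

lemma hasValue_localCoord_x : Q.HasValue (localCoord E.x Q.x) 0 := Q.hasValue_localCoords 0

lemma hasValue_localCoord_y : Q.HasValue (localCoord E.y Q.y) 0 := Q.hasValue_localCoords 1

lemma hasValue_numAt_x : Q.HasValue (numAt E.x Q.x) (hNum Q.x) := by
  rw [numAt_eq]
  simpa using (Q.hasValue_algebraMap (hNum Q.x)).add
    ((Q.hasValue_algebraMap (hDen Q.x)).mul Q.hasValue_localCoord_x)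

lemma hasValue_denAt_x : Q.HasValue (denAt E.x Q.x) (hDen Q.x) := by
  rw [denAt_eq]
  simpa using (Q.hasValue_algebraMap (hDen Q.x)).add
    ((Q.hasValue_algebraMap (1 - hDen Q.x)).mul Q.hasValue_localCoord_x)

lemma hasValue_numAt_y : Q.HasValue (numAt E.y Q.y) (hNum Q.y) := by
  rw [numAt_eq]
  simpa using (Q.hasValue_algebraMap (hNum Q.y)).add
    ((Q.hasValue_algebraMap (hDen Q.y)).mul Q.hasValue_localCoord_y)

lemma hasValue_denAt_y : Q.HasValue (denAt E.y Q.y) (hDen Q.y) := by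
  rw [denAt_eq]
  simpa using (Q.hasValue_algebraMap (hDen Q.y)).add
    ((Q.hasValue_algebraMap (1 - hDen Q.y)).mul Q.hasValue_localCoord_y)

/-- The bihomogeneous equation of the curve holds for the local homogeneous coordinates. -/
lemma equation_numAt_denAt :
    algebraMap K _ E.a * numAt E.x Q.x ^ 2 * denAt E.y Q.y ^ 2
        + numAt E.y Q.y ^ 2 * denAt E.x Q.x ^ 2
      = denAt E.x Q.x ^ 2 * denAt E.y Q.y ^ 2
        + algebraMap K _ E.d * numAt E.x Q.x ^ 2 * numAt E.y Q.y ^ 2 := by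
  have h := E.generic_equation
  have h₁ := E.x_ne_zero
  have h₂ := E.y_ne_zero
  cases Q.x using OnePoint.rec <;> cases Q.y using OnePoint.rec <;>
    simp only [numAt_infty, numAt_some, denAt_infty, denAt_some] <;> field_simp <;>
    linear_combination h

lemma localCoord_x_ne_zero : localCoord E.x Q.x ≠ 0 := by
  cases Q.x using OnePoint.rec with
  | infty => simpa using E.x_ne_zero
  | coe c =>
    rw [localCoord_some, sub_ne_zero]
    intro h
    exact E.transcendental_x (h ▸ isAlgebraic_algebraMap c)

lemma localCoord_y_ne_zero : localCoord E.y Q.y ≠ 0 := by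
  cases Q.y using OnePoint.rec with
  | infty => simpa using E.y_ne_zero
  | coe c =>
    rw [localCoord_some, sub_ne_zero]
    intro h
    have e := E.generic_equation
    rw [h] at e
    refine E.transcendental_x ⟨C (E.a - E.d * c ^ 2) * X ^ 2 + C (c ^ 2 - 1), fun h0 => ?_, ?_⟩
    · have h₂ := congrArg (fun p => coeff p 2) h0
      have h₀ := congrArg (fun p => coeff p 0) h0
      simp [sub_eq_zero, coeff_X_pow, -map_sub, coeff_C] at h₂ h₀
      exact E.a_ne_d (by rcases h₀ with rfl | rfl <;> simpa using h₂)
    · simp only [map_sub, map_add, map_mul, aeval_C, map_pow, aeval_X, map_one]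
      linear_combination e

/-- In the chart around `Q` the curve has an equation of the form `α s² + β t² = γ + δ s² t²`,
where the product of the homogeneous coordinates is the affine coordinate of `Q` in either chart
of the projective line. -/
lemma exists_chart_equation : ∃ α β γ δ : K,
    let s := hNum Q.x * hDen Q.x
    let t := hNum Q.y * hDen Q.y
    let u := localCoord E.x Q.x
    let w := localCoord E.y Q.y
    let s' := u + algebraMap K _ s
    let t' := w + algebraMap K _ t
    γ ≠ 0 ∧ α - δ * t ^ 2 ≠ 0 ∧ β - δ * s ^ 2 ≠ 0 ∧ α * s ^ 2 + β * t ^ 2 = γ + δ * s ^ 2 * t ^ 2 ∧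
    algebraMap K _ α * s' ^ 2 + algebraMap K _ β * t' ^ 2
      = algebraMap K _ γ + algebraMap K _ δ * s' ^ 2 * t' ^ 2 := by
  have nondeg : ∀ {α β γ δ s t : K}, α * β - γ * δ ≠ 0 →
      α * s ^ 2 + β * t ^ 2 = γ + δ * s ^ 2 * t ^ 2 →
      α - δ * t ^ 2 ≠ 0 ∧ β - δ * s ^ 2 ≠ 0 := by
    intro α β γ δ s t h₁ h₂
    constructor <;> intro h <;> apply h₁
    · linear_combination (β - δ * s ^ 2) * h + δ * h₂
    · linear_combination (α - δ * t ^ 2) * h + δ * h₂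
  have hd := E.d_ne_zero
  have had := E.a_ne_d
  have h := E.generic_equation
  have h₁ := E.x_ne_zero
  have h₂ := E.y_ne_zero
  have hQ := Q.eqn
  rw [Equation] at hQ
  cases hx : Q.x using OnePoint.rec with
  | infty =>
    cases hy : Q.y using OnePoint.rec with
    | infty => simp [hx, hy, hd.symm] at hQ
    | coe t =>
      simp only [hx, hy, hNum_infty, hDen_infty, hNum_some, hDen_some] at hQ
      have e : (1 : K) * (1 * 0) ^ 2 + E.d * (t * 1) ^ 2 = E.a + 1 * (1 * 0) ^ 2 * (t * 1) ^ 2 := by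
        linear_combination -hQ
      have n := nondeg (by rw [one_mul, mul_one, sub_ne_zero]; exact had.symm) e
      refine ⟨1, E.d, E.a, 1, E.a_ne_zero, n.1, n.2, e, ?_⟩
      simp
      field_simp
      linear_combination -h
  | coe s =>
    cases hy : Q.y using OnePoint.rec with
    | infty =>
      simp only [hx, hy, hNum_infty, hDen_infty, hNum_some, hDen_some] at hQ
      have e : E.d * (s * 1) ^ 2 + 1 * (1 * 0) ^ 2 = 1 + E.a * (s * 1) ^ 2 * (1 * 0) ^ 2 := by
        linear_combination -hQ
      have n := nondeg (by rw [one_mul, mul_one, sub_ne_zero]; exact had.symm) e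
      refine ⟨E.d, 1, 1, E.a, one_ne_zero, n.1, n.2, e, ?_⟩
      simp
      field_simp
      linear_combination -h
    | coe t =>
      simp only [hx, hy, hNum_some, hDen_some] at hQ
      have e : E.a * (s * 1) ^ 2 + 1 * (t * 1) ^ 2 = 1 + E.d * (s * 1) ^ 2 * (t * 1) ^ 2 := by
        linear_combination hQ
      have n := nondeg (by rw [one_mul, mul_one, sub_ne_zero]; exact had) e
      refine ⟨E.a, 1, 1, E.d, one_ne_zero, n.1, n.2, e, ?_⟩
      simp
      linear_combination h

/-- Each coordinate, centred at `Q`, is a uniformizer unless the other one is `0` or `∞` at `Q`,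
that is, unless `Q` is a branch point of that coordinate, where the order is two. This happens for
at most one of the coordinates. -/
lemma hasOrderAt_localCoord :
    ((hNum Q.y * hDen Q.y ≠ 0 → Q.IsUniformizerAt (localCoord E.x Q.x)) ∧
      (hNum Q.y * hDen Q.y = 0 → Q.HasOrderAt (localCoord E.x Q.x) 2)) ∧
    ((hNum Q.x * hDen Q.x ≠ 0 → Q.IsUniformizerAt (localCoord E.y Q.y)) ∧
      (hNum Q.x * hDen Q.x = 0 → Q.HasOrderAt (localCoord E.y Q.y) 2)) ∧
    (hNum Q.x * hDen Q.x ≠ 0 ∨ hNum Q.y * hDen Q.y ≠ 0) := by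
  obtain ⟨α, β, γ, δ, hγ, hα, hβ, e, h⟩ := Q.exists_chart_equation
  have hu := Q.hasValue_localCoord_x
  have hw := Q.hasValue_localCoord_y
  have hc : ∀ i, Q.localCoords i = localCoord E.x Q.x ∨ Q.localCoords i = localCoord E.y Q.y := by
    intro i
    fin_cases i
    · exact Or.inl rfl
    · exact Or.inr rfl
  have hu0 := Q.localCoord_x_ne_zero
  have hw0 := Q.localCoord_y_ne_zero
  generalize hNum Q.x * hDen Q.x = s at *
  generalize hNum Q.y * hDen Q.y = t at *
  generalize localCoord E.x Q.x = u at *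
  generalize localCoord E.y Q.y = w at *
  have hst : s ≠ 0 ∨ t ≠ 0 := by
    by_contra hst
    push Not at hst
    rw [hst.1, hst.2] at e
    exact hγ (by linear_combination -e)
  have e' := congrArg (algebraMap K E.FunctionField) e
  simp only [map_add, map_mul, map_pow] at e'
  refine ⟨?_, ?_, hst⟩
  · refine hasOrderAt_of_relation hc hu hw hu0 hw0
      (A := algebraMap K _ α - algebraMap K _ δ * (w + algebraMap K _ t) ^ 2)
      (A₀ := α - δ * (0 + t) ^ 2)
      (B := algebraMap K _ (β - δ * s ^ 2))
      ((Q.hasValue_algebraMap _).sub ((Q.hasValue_algebraMap _).mul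
        ((hw.add (Q.hasValue_algebraMap _)).pow 2))) (Q.hasValue_algebraMap _)
      (by simpa using hα) hβ hst ?_
    simp only [map_sub, map_mul, map_pow, map_ofNat]
    linear_combination h - e'
  · refine hasOrderAt_of_relation (fun i => (hc i).symm) hw hu hw0 hu0
      (A := algebraMap K _ β - algebraMap K _ δ * (u + algebraMap K _ s) ^ 2)
      (A₀ := β - δ * (0 + s) ^ 2)
      (B := algebraMap K _ (α - δ * t ^ 2))
      ((Q.hasValue_algebraMap _).sub ((Q.hasValue_algebraMap _).mul
        ((hu.add (Q.hasValue_algebraMap _)).pow 2))) (Q.hasValue_algebraMap _)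
      (by simpa using hβ) hα hst.symm ?_
    simp only [map_sub, map_mul, map_pow, map_ofNat]
    linear_combination h - e'

lemma exists_isUniformizerAt : ∃ t, Q.IsUniformizerAt t := by
  obtain ⟨⟨h₁, -⟩, ⟨h₂, -⟩, h⟩ := Q.hasOrderAt_localCoord
  exact h.elim (fun h => ⟨_, h₂ h⟩) fun h => ⟨_, h₁ h⟩

variable {Q}

lemma IsUnitAt.hasOrderAt {u : E.FunctionField} (hu : Q.IsUnitAt u) : Q.HasOrderAt u 0 := by
  obtain ⟨t, ht⟩ := Q.exists_isUniformizerAt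
  exact ⟨t, u, ht, hu, by simp⟩

lemma HasValue.hasOrderAt {f : E.FunctionField} {v : K} (hf : Q.HasValue f v) (hv : v ≠ 0) :
    Q.HasOrderAt f 0 := (hf.isUnitAt hv).hasOrderAt

lemma HasOrderAt.pow {f : E.FunctionField} {m : ℤ} (hf : Q.HasOrderAt f m) (n : ℕ) :
    Q.HasOrderAt (f ^ n) (n * m) := by
  induction n with
  | zero => simpa using Q.isUnitAt_one.hasOrderAt
  | succ n ih =>
    have e : ((n + 1 : ℕ) : ℤ) * m = n * m + m := by push_cast; ring
    rw [pow_succ, e]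
    exact ih.mul hf

variable (Q)

lemma cross_numAt_denAt (z : E.FunctionField) (c : OnePoint K) :
    algebraMap K _ (hDen c) * numAt z c - algebraMap K _ (hNum c) * denAt z c
      = algebraMap K _ (2 * hDen c - 1) * localCoord z c := by
  have h : (2 : K) - 1 = 1 := by norm_num
  cases c using OnePoint.rec <;> simp [h, -map_sub]

lemma hasOrderAt_sign (c : OnePoint K) :
    Q.HasOrderAt (algebraMap K _ (2 * hDen c - 1)) 0 := by
  refine (Q.hasValue_algebraMap _).hasOrderAt ?_
  cases c using OnePoint.rec
  · simp
  · simp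
    norm_num

/-- The form `hDen c * X - hNum c * Z` on the first projective line vanishes at the points with
first coordinate `c`, doubly if the second coordinate is `0` or `∞`. -/
lemma hasOrderAt_cross_x (c : OnePoint K) : open Classical in
    Q.HasOrderAt (algebraMap K _ (hDen c) * numAt E.x Q.x - algebraMap K _ (hNum c) * denAt E.x Q.x)
      (if Q.x = c then (if hNum Q.y * hDen Q.y = 0 then 2 else 1) else 0) := by
  split_ifs with h₁ h₂
  · subst h₁
    rw [cross_numAt_denAt]
    simpa using (Q.hasOrderAt_sign Q.x).mul (Q.hasOrderAt_localCoord.1.2 h₂)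
  · subst h₁
    rw [cross_numAt_denAt]
    simpa using (Q.hasOrderAt_sign Q.x).mul (Q.hasOrderAt_localCoord.1.1 h₂).hasOrderAt
  · exact (((Q.hasValue_algebraMap _).mul Q.hasValue_numAt_x).sub
      ((Q.hasValue_algebraMap _).mul Q.hasValue_denAt_x)).hasOrderAt fun h => h₁ (eq_of_cross_eq h)

/-- The form `hDen c * Y - hNum c * T` on the second projective line vanishes at the points with
second coordinate `c`, doubly if the first coordinate is `0` or `∞`. -/
lemma hasOrderAt_cross_y (c : OnePoint K) : open Classical in
    Q.HasOrderAt (algebraMap K _ (hDen c) * numAt E.y Q.y - algebraMap K _ (hNum c) * denAt E.y Q.y)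
      (if Q.y = c then (if hNum Q.x * hDen Q.x = 0 then 2 else 1) else 0) := by
  split_ifs with h₁ h₂
  · subst h₁
    rw [cross_numAt_denAt]
    simpa using (Q.hasOrderAt_sign Q.y).mul (Q.hasOrderAt_localCoord.2.1.2 h₂)
  · subst h₁
    rw [cross_numAt_denAt]
    simpa using (Q.hasOrderAt_sign Q.y).mul (Q.hasOrderAt_localCoord.2.1.1 h₂).hasOrderAt
  · exact (((Q.hasValue_algebraMap _).mul Q.hasValue_numAt_y).sub
      ((Q.hasValue_algebraMap _).mul Q.hasValue_denAt_y)).hasOrderAt fun h => h₁ (eq_of_cross_eq h)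

lemma hasOrderAt_denAt_x : open Classical in
    Q.HasOrderAt (denAt E.x Q.x) (if Q.x = OnePoint.infty then 1 else 0) := by
  split_ifs with h
  · have h₁ : Q.IsUniformizerAt (localCoord E.x Q.x) :=
      Q.hasOrderAt_localCoord.1.1 (Q.hasOrderAt_localCoord.2.2.resolve_left (by simp [h]))
    rw [h] at h₁ ⊢
    exact h₁.hasOrderAt
  · refine Q.hasValue_denAt_x.hasOrderAt ?_
    cases hc : Q.x using OnePoint.rec <;> simp_all

lemma hasOrderAt_denAt_y : open Classical in
    Q.HasOrderAt (denAt E.y Q.y) (if Q.y = OnePoint.infty then 1 else 0) := by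
  split_ifs with h
  · have h₁ : Q.IsUniformizerAt (localCoord E.y Q.y) :=
      Q.hasOrderAt_localCoord.2.1.1 (Q.hasOrderAt_localCoord.2.2.resolve_right (by simp [h]))
    rw [h] at h₁ ⊢
    exact h₁.hasOrderAt
  · refine Q.hasValue_denAt_y.hasOrderAt ?_
    cases hc : Q.y using OnePoint.rec <;> simp_all

lemma x_ne_infty_or_y_ne_infty : Q.x ≠ OnePoint.infty ∨ Q.y ≠ OnePoint.infty := by
  by_contra! h
  simpa [h.1, h.2] using Q.hasOrderAt_localCoord.2.2

end Charts

end Point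

/-! ### The group law as a symmetric relation -/

/-- Vieta's formulas `e₀`, …, `e₃` for the roots `(Yᵢ : Tᵢ)` of the binary cubic form
`A² (Y + T) (a T² - d Y²) - (T - Y) (B T + D Y)²` imply both addition laws for the three points with
second coordinates `(Yᵢ : Tᵢ)` and first coordinates `(-A (Yᵢ + Tᵢ) : B Tᵢ + D Yᵢ)`: their sum is
zero. -/
lemma cubic_relations {F : Type*} [Field F] {a d A B D c Y₁ T₁ Y₂ T₂ Y₃ T₃ : F} (hc : c ≠ 0)
    (e₀ : c * (T₁ * T₂ * T₃) = D ^ 2 - d * A ^ 2)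
    (e₁ : c * (Y₁ * T₂ * T₃ + T₁ * Y₂ * T₃ + T₁ * T₂ * Y₃) = d * A ^ 2 + D ^ 2 - 2 * B * D)
    (e₂ : c * (T₁ * Y₂ * Y₃ + Y₁ * T₂ * Y₃ + Y₁ * Y₂ * T₃) = a * A ^ 2 + B ^ 2 - 2 * B * D)
    (e₃ : c * (Y₁ * Y₂ * Y₃) = B ^ 2 - a * A ^ 2) :
    (-A * (Y₁ + T₁) * Y₂ * (B * T₂ + D * Y₂) * T₁ + -A * (Y₂ + T₂) * Y₁ * (B * T₁ + D * Y₁) * T₂)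
      * (B * T₃ + D * Y₃) + (-A * (Y₃ + T₃)) * ((B * T₁ + D * Y₁) * (B * T₂ + D * Y₂) * T₁ * T₂ +
      d * (-A * (Y₁ + T₁)) * (-A * (Y₂ + T₂)) * Y₁ * Y₂) = 0 ∧
    (Y₁ * Y₂ * (B * T₁ + D * Y₁) * (B * T₂ + D * Y₂)
      - a * (-A * (Y₁ + T₁)) * (-A * (Y₂ + T₂)) * T₁ * T₂) * T₃
      - Y₃ * ((B * T₁ + D * Y₁) * (B * T₂ + D * Y₂) * T₁ * T₂ -
      d * (-A * (Y₁ + T₁)) * (-A * (Y₂ + T₂)) * Y₁ * Y₂) = 0 ∧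
    (-A * (Y₁ + T₁) * Y₁ * (B * T₂ + D * Y₂) * T₂ + -A * (Y₂ + T₂) * Y₂ * (B * T₁ + D * Y₁) * T₁)
      * (B * T₃ + D * Y₃) + (-A * (Y₃ + T₃)) * (a * (-A * (Y₁ + T₁)) * (-A * (Y₂ + T₂)) * T₁ * T₂
      + Y₁ * Y₂ * (B * T₁ + D * Y₁) * (B * T₂ + D * Y₂)) = 0 ∧
    (-A * (Y₁ + T₁) * Y₁ * (B * T₂ + D * Y₂) * T₂ - -A * (Y₂ + T₂) * Y₂ * (B * T₁ + D * Y₁) * T₁)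
      * T₃ - Y₃ * (-A * (Y₁ + T₁) * Y₂ * (B * T₂ + D * Y₂) * T₁
      - -A * (Y₂ + T₂) * Y₁ * (B * T₁ + D * Y₁) * T₂) = 0 := by
  have h : B * (T₁ * T₂ * T₃ + (Y₁ * T₂ * T₃ + T₁ * Y₂ * T₃ + T₁ * T₂ * Y₃))
      + D * ((T₁ * Y₂ * Y₃ + Y₁ * T₂ * Y₃ + Y₁ * Y₂ * T₃) + Y₁ * Y₂ * Y₃) = 0 := by
    apply mul_left_cancel₀ hc
    linear_combination B * (e₀ + e₁) + D * (e₂ + e₃)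
  refine ⟨?_, ?_, ?_, ?_⟩
  · linear_combination -A * (e₀ * ((Y₁ + T₁) * (Y₂ + T₂) * (Y₃ + T₃)) * Y₁ * Y₂
      - T₁ * T₂ * T₃ * Y₁ * Y₂ * (e₀ + e₁ + e₂ + e₃)
      + h * (B * T₁ * T₂ + D * (Y₁ * Y₂ + T₁ * Y₂ + T₂ * Y₁)))
  · clear hc; grind
  · clear hc; grind
  · clear hc; grind

lemma ofHom_eq {F : Type*} [Field F] {X Z : F} {c : OnePoint F} (h₀ : ¬ (X = 0 ∧ Z = 0))
    (h : X * hDen c - hNum c * Z = 0) : ofHom X Z = c := by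
  cases c using OnePoint.rec with
  | infty => simp_all [ofHom]
  | coe c =>
    simp only [hDen_some, mul_one, hNum_some] at h
    have hZ : Z ≠ 0 := by rintro rfl; simp_all
    rw [ofHom, if_neg hZ, sub_eq_zero.mp h, mul_div_cancel_right₀ _ hZ]

lemma ofHom_eq_neg {F : Type*} [Field F] {X Z : F} {c : OnePoint F} (h₀ : ¬ (X = 0 ∧ Z = 0))
    (h : X * hDen c + hNum c * Z = 0) : ofHom X Z = OnePoint.map (fun x => -x) c := by
  refine ofHom_eq h₀ ?_
  cases c using OnePoint.rec with
  | infty => simpa using h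
  | coe c => simpa using h

namespace Point

section GroupLaw

variable {F : Type*} [Field F] {E : TwistedEdwards F}

/-- The relation `P + Q + S = 0`, in the form that both addition laws satisfy it as an identity
between homogeneous coordinates (which is void where an addition law is undefined). -/
def SumZero (P Q S : E.Point) : Prop :=
  P.sumX Q * hDen S.x + hNum S.x * P.sumZ Q = 0 ∧ P.sumY Q * hDen S.y - hNum S.y * P.sumT Q = 0 ∧
  P.dualX Q * hDen S.x + hNum S.x * P.dualZ Q = 0 ∧ P.dualY Q * hDen S.y - hNum S.y * P.dualT Q = 0

lemma SumZero.symm {P Q S : E.Point} (h : P.SumZero Q S) : Q.SumZero P S := by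
  obtain ⟨h₁, h₂, h₃, h₄⟩ := h
  simp only [SumZero, sumX, sumY, sumZ, sumT, dualX, dualY, dualZ, dualT] at *
  refine ⟨?_, ?_, ?_, ?_⟩
  · linear_combination h₁
  · linear_combination h₂
  · linear_combination h₃
  · linear_combination -h₄

lemma neg_x (P : E.Point) : (-P).x = OnePoint.map (fun c => -c) P.x := rfl

lemma neg_y (P : E.Point) : (-P).y = P.y := rfl

lemma SumZero.add_eq {P Q S : E.Point} (h : P.SumZero Q S) : P + Q = -S := by
  obtain ⟨h₁, h₂, h₃, h₄⟩ := h
  by_cases hd : P.SumDefined Q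
  · have e : P + Q = ⟨_, _, equation_ofHom (P.equation_sum Q) hd.1 hd.2⟩ := dif_pos hd
    rw [e]
    exact Point.ext (ofHom_eq_neg hd.1 h₁) (ofHom_eq hd.2 h₂)
  · have hd' := P.dualDefined_of_not_sumDefined Q hd
    have e : P + Q = ⟨_, _, equation_ofHom (P.equation_dual Q) hd'.1 hd'.2⟩ := dif_neg hd
    rw [e]
    exact Point.ext (ofHom_eq_neg hd'.1 h₃) (ofHom_eq hd'.2 h₄)

lemma zero_x : (0 : E.Point).x = OnePoint.some 0 := rfl
lemma zero_y : (0 : E.Point).y = OnePoint.some 1 := rfl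
lemma O'_x : (O' : E.Point).x = OnePoint.some 0 := rfl
lemma O'_y : (O' : E.Point).y = OnePoint.some (-1) := rfl

protected lemma neg_neg (P : E.Point) : - -P = P := by
  refine Point.ext ?_ rfl
  rw [neg_x, neg_x]
  cases P.x using OnePoint.rec <;> simp

protected lemma neg_zero : -(0 : E.Point) = 0 := by
  refine Point.ext ?_ rfl
  rw [neg_x, zero_x]
  simp

/-- The point `(x, -y)`, which is `O' - (x, y)`. -/
def flip (P : E.Point) : E.Point where
  x := P.x
  y := OnePoint.map (fun c => -c) P.y
  eqn := by
    obtain ⟨x, y, h⟩ := P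
    cases y using OnePoint.rec <;> simpa [Equation] using h

lemma flip_x (P : E.Point) : P.flip.x = P.x := rfl

lemma flip_y (P : E.Point) : P.flip.y = OnePoint.map (fun c => -c) P.y := rfl

lemma sumZero_zero (P : E.Point) :
    P.SumZero (-P) 0 ∧ SumZero (-P) 0 P ∧ P.SumZero 0 (-P) := by
  obtain ⟨x, y, h⟩ := P
  cases x using OnePoint.rec <;> cases y using OnePoint.rec <;>
  simp [SumZero, sumX, sumY, sumZ, sumT, dualX, dualY, dualZ, dualT, neg_x, neg_y, zero_x, zero_y,
    Equation] at h ⊢ <;> grind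

lemma sumZero_O' (P : E.Point) :
    P.SumZero P.flip O' ∧ SumZero P.flip O' P ∧ P.SumZero O' P.flip := by
  obtain ⟨x, y, h⟩ := P
  cases x using OnePoint.rec <;> cases y using OnePoint.rec <;>
  simp [SumZero, sumX, sumY, sumZ, sumT, dualX, dualY, dualZ, dualT, flip_x, flip_y, O'_x, O'_y,
    Equation] at h ⊢ <;> grind

protected lemma add_neg_self (P : E.Point) : P + -P = 0 := by
  rw [(sumZero_zero P).1.add_eq, Point.neg_zero]

end GroupLaw

/-! ### Base change -/

section Functoriality

variable {F : Type*} [Field F] (K : Type*) [Field K] [Algebra F K] {E : TwistedEdwards F}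

lemma map_ofHom (X Z : F) : OnePoint.map (algebraMap F K) (ofHom X Z)
    = ofHom (algebraMap F K X) (algebraMap F K Z) := by
  by_cases h : Z = 0 <;> simp [ofHom, h]

lemma baseChange_injective : Function.Injective (Point.baseChange K : E.Point → _) := by
  intro P Q h
  have hinj : Function.Injective (OnePoint.map (algebraMap F K)) :=
    Option.map_injective (algebraMap F K).injective
  exact Point.ext (hinj (congrArg Point.x h)) (hinj (congrArg Point.y h))

lemma hNum_baseChange_x (R : E.Point) :
    hNum (R.baseChange K).x = algebraMap F K (hNum R.x) := hNum_map K _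

lemma hDen_baseChange_x (R : E.Point) :
    hDen (R.baseChange K).x = algebraMap F K (hDen R.x) := hDen_map K _

lemma hNum_baseChange_y (R : E.Point) :
    hNum (R.baseChange K).y = algebraMap F K (hNum R.y) := hNum_map K _

lemma hDen_baseChange_y (R : E.Point) :
    hDen (R.baseChange K).y = algebraMap F K (hDen R.y) := hDen_map K _

lemma baseChange_neg (P : E.Point) : (-P).baseChange K = -(P.baseChange K) := by
  refine Point.ext ?_ rfl
  change OnePoint.map _ (OnePoint.map _ P.x) = OnePoint.map _ (OnePoint.map _ P.x)
  cases P.x using OnePoint.rec <;> simp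

lemma baseChange_zero : (0 : E.Point).baseChange K = 0 := by
  refine Point.ext ?_ ?_
  · change OnePoint.map _ (OnePoint.some 0) = OnePoint.some 0
    simp
  · change OnePoint.map _ (OnePoint.some 1) = OnePoint.some 1
    simp

lemma baseChange_O' : (O' : E.Point).baseChange K = O' := by
  refine Point.ext ?_ ?_
  · change OnePoint.map _ (OnePoint.some 0) = OnePoint.some 0
    simp
  · change OnePoint.map _ (OnePoint.some (-1)) = OnePoint.some (-1)
    simp

lemma baseChange_add (P Q : E.Point) :
    (P + Q).baseChange K = P.baseChange K + Q.baseChange K := by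
  have ha : (E.baseChange K).a = algebraMap F K E.a := rfl
  have hd : (E.baseChange K).d = algebraMap F K E.d := rfl
  have e₁ : (P.baseChange K).sumX (Q.baseChange K) = algebraMap F K (P.sumX Q) := by
    simp [sumX, hNum_baseChange_x, hNum_baseChange_y, hDen_baseChange_x,
      hDen_baseChange_y]
  have e₂ : (P.baseChange K).sumY (Q.baseChange K) = algebraMap F K (P.sumY Q) := by
    simp [sumY, hNum_baseChange_x, hNum_baseChange_y, hDen_baseChange_x,
      hDen_baseChange_y, ha]
  have e₃ : (P.baseChange K).sumZ (Q.baseChange K) = algebraMap F K (P.sumZ Q) := by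
    simp [sumZ, hNum_baseChange_x, hNum_baseChange_y, hDen_baseChange_x,
      hDen_baseChange_y, hd]
  have e₄ : (P.baseChange K).sumT (Q.baseChange K) = algebraMap F K (P.sumT Q) := by
    simp [sumT, hNum_baseChange_x, hNum_baseChange_y, hDen_baseChange_x,
      hDen_baseChange_y, hd]
  have e₅ : (P.baseChange K).dualX (Q.baseChange K) = algebraMap F K (P.dualX Q) := by
    simp [dualX, hNum_baseChange_x, hNum_baseChange_y, hDen_baseChange_x,
      hDen_baseChange_y]
  have e₆ : (P.baseChange K).dualY (Q.baseChange K) = algebraMap F K (P.dualY Q) := by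
    simp [dualY, hNum_baseChange_x, hNum_baseChange_y, hDen_baseChange_x,
      hDen_baseChange_y]
  have e₇ : (P.baseChange K).dualZ (Q.baseChange K) = algebraMap F K (P.dualZ Q) := by
    simp [dualZ, hNum_baseChange_x, hNum_baseChange_y, hDen_baseChange_x,
      hDen_baseChange_y, ha]
  have e₈ : (P.baseChange K).dualT (Q.baseChange K) = algebraMap F K (P.dualT Q) := by
    simp [dualT, hNum_baseChange_x, hNum_baseChange_y, hDen_baseChange_x,
      hDen_baseChange_y]
  have hiff : (P.baseChange K).SumDefined (Q.baseChange K) ↔ P.SumDefined Q := by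
    simp [SumDefined, e₁, e₂, e₃, e₄]
  by_cases h : P.SumDefined Q
  · have h' := hiff.mpr h
    have e : P + Q = ⟨_, _, equation_ofHom (P.equation_sum Q) h.1 h.2⟩ := dif_pos h
    have e' : P.baseChange K + Q.baseChange K =
      ⟨_, _, equation_ofHom (equation_sum _ _) h'.1 h'.2⟩ := dif_pos h'
    rw [e, e']
    refine Point.ext ?_ ?_
    · change OnePoint.map _ (ofHom _ _) = ofHom _ _
      rw [map_ofHom, e₁, e₃]
    · change OnePoint.map _ (ofHom _ _) = ofHom _ _
      rw [map_ofHom, e₂, e₄]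
  · have h' := mt hiff.mp h
    have k := P.dualDefined_of_not_sumDefined Q h
    have k' := dualDefined_of_not_sumDefined _ _ h'
    have e : P + Q = ⟨_, _, equation_ofHom (P.equation_dual Q) k.1 k.2⟩ := dif_neg h
    have e' : P.baseChange K + Q.baseChange K =
      ⟨_, _, equation_ofHom (equation_dual _ _) k'.1 k'.2⟩ := dif_neg h'
    rw [e, e']
    refine Point.ext ?_ ?_
    · change OnePoint.map _ (ofHom _ _) = ofHom _ _
      rw [map_ofHom, e₅, e₇]
    · change OnePoint.map _ (ofHom _ _) = ofHom _ _
      rw [map_ofHom, e₆, e₈]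

end Functoriality

end Point

/-! ### Factorization of binary forms -/

section BinaryForms

variable {K : Type*} [Field K]

lemma exists_linear_factor (n₁ n₀ : K) : ∃ (c : K) (r : OnePoint K),
    c * hDen r = n₁ ∧ -(c * hNum r) = n₀ := by
  by_cases h : -n₀ = 0 ∧ n₁ = 0
  · exact ⟨0, OnePoint.infty, by simp [h.2], by simp [neg_eq_zero.mp h.1]⟩
  · obtain ⟨c, -, h₁, h₂⟩ := exists_ofHom h
    exact ⟨c, _, h₂.symm, by rw [← h₁, neg_neg]⟩

lemma exists_quadratic_factors [IsAlgClosed K] (n₂ n₁ n₀ : K) : ∃ (c : K) (r s : OnePoint K),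
    c * (hDen r * hDen s) = n₂ ∧ -(c * (hNum r * hDen s + hDen r * hNum s)) = n₁ ∧
    c * (hNum r * hNum s) = n₀ := by
  by_cases h : n₂ = 0
  · obtain ⟨c, r, h₁, h₂⟩ := exists_linear_factor n₁ n₀
    refine ⟨-c, r, OnePoint.infty, by simp [h], ?_, ?_⟩
    · simp only [hNum_infty, hDen_infty]
      linear_combination h₁
    · simp only [hNum_infty]
      linear_combination h₂
  · obtain ⟨t, ht⟩ := IsAlgClosed.exists_root (C n₂ * X ^ 2 + C n₁ * X + C n₀)
      (by rw [degree_quadratic h]; decide)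
    simp only [IsRoot.def, eval_add, eval_mul, eval_C, eval_pow, eval_X] at ht
    obtain ⟨c, r, h₁, h₂⟩ := exists_linear_factor n₂ (n₁ + n₂ * t)
    refine ⟨c, r, OnePoint.some t, ?_, ?_, ?_⟩ <;> simp only [hNum_some, hDen_some]
    · linear_combination h₁
    · linear_combination h₂ - t * h₁
    · linear_combination -t * h₂ - ht

/-- A binary cubic form over an algebraically closed field is a product of linear forms. -/
lemma exists_cubic_factors [IsAlgClosed K] (n₃ n₂ n₁ n₀ : K) : ∃ (c : K) (r s t : OnePoint K),
    c * (hDen r * hDen s * hDen t) = n₃ ∧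
    -(c * (hNum r * hDen s * hDen t + hDen r * hNum s * hDen t + hDen r * hDen s * hNum t)) = n₂ ∧
    c * (hDen r * hNum s * hNum t + hNum r * hDen s * hNum t + hNum r * hNum s * hDen t) = n₁ ∧
    -(c * (hNum r * hNum s * hNum t)) = n₀ := by
  by_cases h : n₃ = 0
  · obtain ⟨c, r, s, h₁, h₂, h₃⟩ := exists_quadratic_factors n₂ n₁ n₀
    refine ⟨-c, r, s, OnePoint.infty, by simp [h], ?_, ?_, ?_⟩ <;>
      simp only [hNum_infty, hDen_infty]
    · linear_combination h₁
    · linear_combination h₂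
    · linear_combination h₃
  · obtain ⟨t, ht⟩ := IsAlgClosed.exists_root (C n₃ * X ^ 3 + C n₂ * X ^ 2 + C n₁ * X + C n₀)
      (by rw [degree_cubic h]; decide)
    simp only [IsRoot.def, eval_add, eval_mul, eval_C, eval_pow, eval_X] at ht
    obtain ⟨c, r, s, h₁, h₂, h₃⟩ :=
      exists_quadratic_factors n₃ (n₂ + n₃ * t) (n₁ + (n₂ + n₃ * t) * t)
    refine ⟨c, r, s, OnePoint.some t, ?_, ?_, ?_, ?_⟩ <;> simp only [hNum_some, hDen_some]
    · linear_combination h₁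
    · linear_combination h₂ - t * h₁
    · linear_combination h₃ - t * h₂
    · linear_combination -t * h₃ - ht

end BinaryForms

/-! ### Coordinate lines -/

namespace Point

section Fibres

variable {K : Type*} [Field K] {E : TwistedEdwards K}

lemma toDivisor_apply (P Q : E.Point) : open Classical in
    P.toDivisor Q = if Q = P then 1 else 0 := by
  classical
  rw [toDivisor, Finsupp.single_apply]
  simp only [eq_comm]

lemma toDivisor_nonneg (P Q : E.Point) : 0 ≤ P.toDivisor Q := by
  classical
  rw [toDivisor_apply]
  split_ifs <;> norm_num

lemma eq_neg_of_mul {b c : OnePoint K} (h : hNum b * hDen c = -(hNum c * hDen b)) :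
    b = OnePoint.map (fun x => -x) c := by
  cases b using OnePoint.rec <;> cases c using OnePoint.rec <;> simp_all

lemma eq_of_mul {b c : OnePoint K} (h : hNum b * hDen c = hNum c * hDen b) : b = c :=
  eq_of_cross_eq (by linear_combination h)

lemma eq_or_eq_neg {p q : K} {b c : OnePoint K} (h : p ≠ 0 ∨ q ≠ 0)
    (hb : hNum b ^ 2 * p = hDen b ^ 2 * q) (hc : hNum c ^ 2 * p = hDen c ^ 2 * q) :
    b = c ∨ b = OnePoint.map (fun x => -x) c := by
  have e : (hNum b * hDen c) ^ 2 = (hNum c * hDen b) ^ 2 := by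
    rcases h with h | h
    · apply mul_right_cancel₀ h
      linear_combination hDen c ^ 2 * hb - hDen b ^ 2 * hc
    · apply mul_right_cancel₀ h
      linear_combination hNum c ^ 2 * hb - hNum b ^ 2 * hc
  exact (sq_eq_sq_iff_eq_or_eq_neg.mp e).imp eq_of_mul eq_neg_of_mul

/-- A point of the pair `c`, `-c` occurs twice in it exactly if it is `0` or `∞`. -/
lemma count_eq_or_eq_neg (h2 : (2 : K) ≠ 0) {b c : OnePoint K}
    (h : b = c ∨ b = OnePoint.map (fun x => -x) c) : open Classical in
    ((if b = c then 1 else 0) + (if b = OnePoint.map (fun x => -x) c then 1 else 0) : ℤ)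
      = if hNum b * hDen b = 0 then 2 else 1 := by
  cases b using OnePoint.rec with
  | infty => cases c using OnePoint.rec <;> simp_all
  | coe b =>
    cases c using OnePoint.rec with
    | infty => simp at h
    | coe c =>
      simp only [OnePoint.map_some, OnePoint.coe_eq_coe, hNum_some, hDen_some, mul_one] at h ⊢
      by_cases hc : c = 0
      · subst hc
        simp_all
      · have hcc : c ≠ -c := fun h => hc (by
          have : 2 * c = 0 := by linear_combination h
          exact (mul_eq_zero.mp this).resolve_left h2)
        rcases h with rfl | rfl
        · simp [hc, hcc]
        · simp [hc, hcc.symm]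

variable (Q S : E.Point)

lemma eqn_x : hNum Q.x ^ 2 * (E.a * hDen Q.y ^ 2 - E.d * hNum Q.y ^ 2)
    = hDen Q.x ^ 2 * (hDen Q.y ^ 2 - hNum Q.y ^ 2) := by
  have := Q.eqn
  rw [Equation] at this
  linear_combination this

lemma eqn_y : hNum Q.y ^ 2 * (hDen Q.x ^ 2 - E.d * hNum Q.x ^ 2)
    = hDen Q.y ^ 2 * (hDen Q.x ^ 2 - E.a * hNum Q.x ^ 2) := by
  have := Q.eqn
  rw [Equation] at this
  linear_combination this

variable (E) in
/-- The equation `X² (a T² - d Y²) = Z² (T² - Y²)` of the points with given second coordinate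
`(Y : T)` is not void. -/
lemma fibre_y_ne_zero (c : OnePoint K) :
    E.a * hDen c ^ 2 - E.d * hNum c ^ 2 ≠ 0 ∨ hDen c ^ 2 - hNum c ^ 2 ≠ 0 := by
  by_contra! h
  have had := sub_ne_zero.mpr E.a_ne_d
  have h₁ : (E.a - E.d) * hDen c ^ 2 = 0 := by linear_combination h.1 - E.d * h.2
  have h₂ := (pow_eq_zero_iff (_root_.two_ne_zero)).mp ((mul_eq_zero.mp h₁).resolve_left had)
  have h₃ : hNum c ^ 2 = 0 := by rw [h₂] at h; linear_combination -h.2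
  exact (hNum_or_hDen c).elim (fun h => h ((pow_eq_zero_iff (_root_.two_ne_zero)).mp h₃))
    fun h => h h₂

variable (E) in
/-- The equation `Y² (Z² - d X²) = T² (Z² - a X²)` of the points with given first coordinate
`(X : Z)` is not void. -/
lemma fibre_x_ne_zero (c : OnePoint K) :
    hDen c ^ 2 - E.d * hNum c ^ 2 ≠ 0 ∨ hDen c ^ 2 - E.a * hNum c ^ 2 ≠ 0 := by
  by_contra! h
  have had := sub_ne_zero.mpr E.a_ne_d
  have h₁ : (E.a - E.d) * hNum c ^ 2 = 0 := by linear_combination h.1 - h.2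
  have h₂ := (pow_eq_zero_iff (_root_.two_ne_zero)).mp ((mul_eq_zero.mp h₁).resolve_left had)
  have h₃ : hDen c ^ 2 = 0 := by rw [h₂] at h; linear_combination h.1
  exact (hNum_or_hDen c).elim (fun h => h h₂)
    fun h => h ((pow_eq_zero_iff (_root_.two_ne_zero)).mp h₃)

lemma exists_ratio [IsAlgClosed K] {p q : K} : ∃ c : OnePoint K,
    hNum c ^ 2 * p = hDen c ^ 2 * q := by
  by_cases h : p = 0
  · exact ⟨OnePoint.infty, by simp [h]⟩
  · obtain ⟨z, hz⟩ := IsAlgClosed.exists_pow_nat_eq (q / p) two_pos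
    refine ⟨OnePoint.some z, ?_⟩
    rw [hNum_some, hDen_some, hz]
    field_simp

lemma exists_y_eq [IsAlgClosed K] (E : TwistedEdwards K) (c : OnePoint K) :
    ∃ S : E.Point, S.y = c := by
  obtain ⟨b, hb⟩ := exists_ratio (p := E.a * hDen c ^ 2 - E.d * hNum c ^ 2)
    (q := hDen c ^ 2 - hNum c ^ 2)
  exact ⟨⟨b, c, by rw [Equation]; linear_combination hb⟩, rfl⟩

lemma exists_x_eq [IsAlgClosed K] (E : TwistedEdwards K) (c : OnePoint K) :
    ∃ S : E.Point, S.x = c := by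
  obtain ⟨b, hb⟩ := exists_ratio (p := hDen c ^ 2 - E.d * hNum c ^ 2)
    (q := hDen c ^ 2 - E.a * hNum c ^ 2)
  exact ⟨⟨c, b, by rw [Equation]; linear_combination hb⟩, rfl⟩

/-- The line `y = y(S)` meets the curve in `S` and `-S`. -/
lemma hasOrderAt_fibre_y : Q.HasOrderAt
    (algebraMap K _ (hDen S.y) * numAt E.y Q.y - algebraMap K _ (hNum S.y) * denAt E.y Q.y)
    ((S.toDivisor + (-S).toDivisor) Q) := by
  classical
  convert Q.hasOrderAt_cross_y S.y using 1
  rw [Finsupp.add_apply, toDivisor_apply, toDivisor_apply]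
  by_cases hy : Q.y = S.y
  · have h := eq_or_eq_neg (fibre_y_ne_zero E S.y) (hy ▸ Q.eqn_x) S.eqn_x
    have h₁ : Q = S ↔ Q.x = S.x := by simp [Point.ext_iff, hy]
    have h₂ : Q = -S ↔ Q.x = OnePoint.map (fun x => -x) S.x := by
      simp [Point.ext_iff, hy, neg_x, neg_y]
    rw [if_pos hy, ← count_eq_or_eq_neg E.two_ne_zero h]
    simp only [h₁, h₂]
  · have h₁ : Q ≠ S := fun h => hy (by rw [h])
    have h₂ : Q ≠ -S := fun h => hy (by rw [h, neg_y])
    simp [h₁, h₂, hy]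

/-- The line `x = x(S)` meets the curve in `S = (x, y)` and `(x, -y)`. -/
lemma hasOrderAt_fibre_x : Q.HasOrderAt
    (algebraMap K _ (hDen S.x) * numAt E.x Q.x - algebraMap K _ (hNum S.x) * denAt E.x Q.x)
    ((S.toDivisor + S.flip.toDivisor) Q) := by
  classical
  convert Q.hasOrderAt_cross_x S.x using 1
  rw [Finsupp.add_apply, toDivisor_apply, toDivisor_apply]
  by_cases hx : Q.x = S.x
  · have h := eq_or_eq_neg (fibre_x_ne_zero E S.x) (hx ▸ Q.eqn_y) S.eqn_y
    have h₁ : Q = S ↔ Q.y = S.y := by simp [Point.ext_iff, hx]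
    have h₂ : Q = S.flip ↔ Q.y = OnePoint.map (fun x => -x) S.y := by
      simp [Point.ext_iff, hx, flip_x, flip_y]
    rw [if_pos hx, ← count_eq_or_eq_neg E.two_ne_zero h]
    simp only [h₁, h₂]
  · have h₁ : Q ≠ S := fun h => hx (by rw [h])
    have h₂ : Q ≠ S.flip := fun h => hx (by rw [h, flip_x])
    simp [h₁, h₂, hx]

end Fibres

end Point

/-! ### The divisor of a conic through the nodes -/

namespace Point

section ConicDivisor

variable {K : Type*} [Field K] {E : TwistedEdwards K}

/-- The function `A (Z² + Y Z) + B X Z + D X Y` on the plane curve, whose zero set is the general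
conic through `O'` and the two nodes. It is written as the bihomogeneous form
`A (Y + T) Z + X (B T + D Y)` on `ℙ¹ × ℙ¹`, in homogeneous coordinates that are regular at `Q` and
do not vanish there simultaneously. -/
noncomputable def conicAt (A B D : K) (Q : E.Point) : E.FunctionField :=
  algebraMap K _ A * (numAt E.y Q.y + denAt E.y Q.y) * denAt E.x Q.x
    + numAt E.x Q.x * (algebraMap K _ B * denAt E.y Q.y + algebraMap K _ D * numAt E.y Q.y)

/-- The value at `Q` of `conicAt A B D Q`. -/
def conicValue (A B D : K) (Q : E.Point) : K :=
  A * (hNum Q.y + hDen Q.y) * hDen Q.x + hNum Q.x * (B * hDen Q.y + D * hNum Q.y)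

lemma conicValue_O' (A B D : K) :
    conicValue A B D (O' : E.Point) = 0 := by
  simp [conicValue, O'_x, O'_y]

lemma hasValue_conicAt (A B D : K) (Q : E.Point) :
    Q.HasValue (conicAt A B D Q) (conicValue A B D Q) :=
  (((Q.hasValue_algebraMap A).mul (Q.hasValue_numAt_y.add Q.hasValue_denAt_y)).mul
    Q.hasValue_denAt_x).add (Q.hasValue_numAt_x.mul (((Q.hasValue_algebraMap B).mul
    Q.hasValue_denAt_y).add ((Q.hasValue_algebraMap D).mul Q.hasValue_numAt_y)))

/-- The sum of the three points is zero, as a relation that is symmetric in them. -/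
def SumZero₃ (S₁ S₂ S₃ : E.Point) : Prop :=
  S₁.SumZero S₂ S₃ ∧ S₂.SumZero S₃ S₁ ∧ S₁.SumZero S₃ S₂

/-- `A (Y + T) Z + X (B T + D Y)` is reducible for `A = 0`: it is a line through `O` and `O'`
times a line through a point `S` and `-S`. -/
lemma exists_divisor_of_eq_zero [IsAlgClosed K] {B D : K} (h : ¬ (B = 0 ∧ D = 0)) :
    ∃ S₁ S₂ S₃ : E.Point, SumZero₃ S₁ S₂ S₃ ∧ ∀ Q : E.Point, Q.HasOrderAt (conicAt 0 B D Q)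
      ((S₁.toDivisor + S₂.toDivisor + S₃.toDivisor + O'.toDivisor : E.Point →₀ ℤ) Q) := by
  obtain ⟨k, hk, hB, hD⟩ := exists_ofHom (X := -B) (Z := D) (by simpa using h)
  obtain ⟨S, hS⟩ := exists_y_eq E (ofHom (-B) D)
  rw [← hS] at hB hD
  obtain ⟨h₁, h₂, h₃⟩ := sumZero_zero S
  refine ⟨S, -S, 0, ⟨h₁, h₂, h₃⟩, fun Q => ?_⟩
  have o := ((Q.hasValue_algebraMap k).hasOrderAt hk).mul
    ((Q.hasOrderAt_fibre_y S).mul (Q.hasOrderAt_fibre_x 0))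
  have hf : (0 : E.Point).flip = O' := Point.ext rfl (by simp [flip_y, zero_y, O'_y])
  rw [hf, zero_x] at o
  have hB' : B = -(k * hNum S.y) := by linear_combination -hB
  convert o using 1
  · rw [conicAt, hB', hD]
    simp only [map_zero, map_neg, map_mul, hDen_some, hNum_some, map_one]
    ring
  · simp only [Finsupp.add_apply]
    ring

/-- `A (Y + T) Z + X (B T + D Y)` is reducible for `B = D`: it is the tangent line at `O'` times a
line through two points `(x, y)` and `(x, -y)`. -/
lemma exists_divisor_of_eq [IsAlgClosed K] {A B : K} (h : ¬ (A = 0 ∧ B = 0)) :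
    ∃ S₁ S₂ S₃ : E.Point, SumZero₃ S₁ S₂ S₃ ∧ ∀ Q : E.Point, Q.HasOrderAt (conicAt A B B Q)
      ((S₁.toDivisor + S₂.toDivisor + S₃.toDivisor + O'.toDivisor : E.Point →₀ ℤ) Q) := by
  obtain ⟨k, hk, hA, hB⟩ := exists_ofHom (X := -A) (Z := B) (by simpa using h)
  obtain ⟨S, hS⟩ := exists_x_eq E (ofHom (-A) B)
  rw [← hS] at hA hB
  obtain ⟨h₁, h₂, h₃⟩ := sumZero_O' S
  refine ⟨S, S.flip, O', ⟨h₁, h₂, h₃⟩, fun Q => ?_⟩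
  have o := ((Q.hasValue_algebraMap k).hasOrderAt hk).mul
    ((Q.hasOrderAt_fibre_x S).mul (Q.hasOrderAt_fibre_y O'))
  have hf : -(O' : E.Point) = O' := Point.ext (by simp [neg_x, O'_x]) rfl
  rw [hf, O'_y] at o
  have hA' : A = -(k * hNum S.x) := by linear_combination -hA
  convert o using 1
  · rw [conicAt, hA', hB]
    simp only [map_neg, map_mul, hDen_some, hNum_some, map_one]
    ring
  · simp only [Finsupp.add_apply]
    ring

/-- The point of the irreducible conic `A (Y + T) Z + X (B T + D Y) = 0` with given second
coordinate `y`. -/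
noncomputable def graphX (A B D : K) (y : OnePoint K) : OnePoint K :=
  ofHom (-A * (hNum y + hDen y)) (B * hDen y + D * hNum y)

lemma graphX_defined {A B D : K} (hA : A ≠ 0) (hBD : B ≠ D) (y : OnePoint K) :
    ¬ (-A * (hNum y + hDen y) = 0 ∧ B * hDen y + D * hNum y = 0) := by
  rintro ⟨h₁, h₂⟩
  have h₃ : hNum y = -hDen y := by
    have := (mul_eq_zero.mp h₁).resolve_left (neg_ne_zero.mpr hA)
    linear_combination this
  have h₄ : (B - D) * hDen y = 0 := by rw [h₃] at h₂; linear_combination h₂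
  have h₅ := (mul_eq_zero.mp h₄).resolve_left (sub_ne_zero.mpr hBD)
  rw [h₅, neg_zero] at h₃
  exact (hNum_or_hDen y).elim (fun h => h h₃) fun h => h h₅

lemma conicValue_eq_zero_iff {A B D : K} (hA : A ≠ 0) (hBD : B ≠ D) (Q : E.Point) :
    conicValue A B D Q = 0 ↔ Q.x = graphX A B D Q.y := by
  obtain ⟨k, hk, h₁, h₂⟩ := exists_ofHom (graphX_defined hA hBD Q.y)
  change _ = k * hNum (graphX A B D Q.y) at h₁
  change _ = k * hDen (graphX A B D Q.y) at h₂
  have e : conicValue A B D Q = k * (hDen (graphX A B D Q.y) * hNum Q.x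
      - hNum (graphX A B D Q.y) * hDen Q.x) := by
    rw [conicValue]
    linear_combination -hDen Q.x * h₁ + hNum Q.x * h₂
  rw [e, mul_eq_zero, or_iff_right hk]
  constructor
  · exact eq_of_cross_eq
  · intro h
    rw [← h]
    ring

/-- The second coordinates of the intersections of `A (Y + T) Z + X (B T + D Y) = 0` with the curve
are, besides that of `O'`, the roots of the binary cubic form
`A² (Y + T) (a T² - d Y²) - (T - Y) (B T + D Y)²`. The predicate says that this form is `c` times
the product of the linear forms with roots `y₁`, `y₂`, `y₃`, coefficient by coefficient. -/
def IsFactorization (E : TwistedEdwards K) (A B D c : K) (y₁ y₂ y₃ : OnePoint K) : Prop :=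
  c * (hDen y₁ * hDen y₂ * hDen y₃) = D ^ 2 - E.d * A ^ 2 ∧
  c * (hNum y₁ * hDen y₂ * hDen y₃ + hDen y₁ * hNum y₂ * hDen y₃ + hDen y₁ * hDen y₂ * hNum y₃)
    = E.d * A ^ 2 + D ^ 2 - 2 * B * D ∧
  c * (hDen y₁ * hNum y₂ * hNum y₃ + hNum y₁ * hDen y₂ * hNum y₃ + hNum y₁ * hNum y₂ * hDen y₃)
    = E.a * A ^ 2 + B ^ 2 - 2 * B * D ∧
  c * (hNum y₁ * hNum y₂ * hNum y₃) = B ^ 2 - E.a * A ^ 2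

lemma exists_isFactorization [IsAlgClosed K] (E : TwistedEdwards K) (A B D : K) :
    ∃ c y₁ y₂ y₃, IsFactorization E A B D c y₁ y₂ y₃ := by
  obtain ⟨c, r, s, t, h₁, h₂, h₃, h₄⟩ := exists_cubic_factors (D ^ 2 - E.d * A ^ 2)
    (-(E.d * A ^ 2 + D ^ 2 - 2 * B * D)) (E.a * A ^ 2 + B ^ 2 - 2 * B * D) (-(B ^ 2 - E.a * A ^ 2))
  exact ⟨c, r, s, t, h₁, neg_injective h₂, h₃, neg_injective h₄⟩

lemma IsFactorization.rotate {A B D c : K} {y₁ y₂ y₃ : OnePoint K}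
    (h : IsFactorization E A B D c y₁ y₂ y₃) : IsFactorization E A B D c y₂ y₃ y₁ := by
  obtain ⟨h₁, h₂, h₃, h₄⟩ := h
  exact ⟨by linear_combination h₁, by linear_combination h₂, by linear_combination h₃,
    by linear_combination h₄⟩

lemma IsFactorization.swap {A B D c : K} {y₁ y₂ y₃ : OnePoint K}
    (h : IsFactorization E A B D c y₁ y₂ y₃) : IsFactorization E A B D c y₁ y₃ y₂ := by
  obtain ⟨h₁, h₂, h₃, h₄⟩ := h
  exact ⟨by linear_combination h₁, by linear_combination h₂, by linear_combination h₃,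
    by linear_combination h₄⟩

/-- The identity between forms behind `IsFactorization`, over any extension. -/
lemma IsFactorization.eval {A B D c : K} {y₁ y₂ y₃ : OnePoint K}
    (h : IsFactorization E A B D c y₁ y₂ y₃) {L : Type*} [Field L] [Algebra K L] (Y T : L) :
    algebraMap K L c * ((algebraMap K L (hDen y₁) * Y - algebraMap K L (hNum y₁) * T)
      * (algebraMap K L (hDen y₂) * Y - algebraMap K L (hNum y₂) * T)
      * (algebraMap K L (hDen y₃) * Y - algebraMap K L (hNum y₃) * T))
    = algebraMap K L A ^ 2 * (Y + T) * (algebraMap K L E.a * T ^ 2 - algebraMap K L E.d * Y ^ 2)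
      - (T - Y) * (algebraMap K L B * T + algebraMap K L D * Y) ^ 2 := by
  obtain ⟨h₁, h₂, h₃, h₄⟩ := h
  have k₁ := congrArg (algebraMap K L) h₁
  have k₂ := congrArg (algebraMap K L) h₂
  have k₃ := congrArg (algebraMap K L) h₃
  have k₄ := congrArg (algebraMap K L) h₄
  simp only [map_mul, map_add, map_sub, map_pow, map_ofNat] at k₁ k₂ k₃ k₄
  linear_combination Y ^ 3 * k₁ - Y ^ 2 * T * k₂ + Y * T ^ 2 * k₃ - T ^ 3 * k₄

lemma IsFactorization.eval_root {A B D c : K} {y₁ y₂ y₃ : OnePoint K}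
    (h : IsFactorization E A B D c y₁ y₂ y₃) :
    A ^ 2 * (hNum y₁ + hDen y₁) * (E.a * hDen y₁ ^ 2 - E.d * hNum y₁ ^ 2)
      - (hDen y₁ - hNum y₁) * (B * hDen y₁ + D * hNum y₁) ^ 2 = 0 := by
  have := h.eval (L := K) (hNum y₁) (hDen y₁)
  simp only [Algebra.algebraMap_self, RingHom.id_apply] at this
  rw [← this]
  ring

/-- A root at infinity of the curve, where `a T² = d Y²`, is simple. -/
lemma IsFactorization.ne_of_fibre_eq_zero {A B D c : K} {y₁ y₂ y₃ : OnePoint K}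
    (h : IsFactorization E A B D c y₁ y₂ y₃) (hA : A ≠ 0)
    (h₁ : E.a * hDen y₁ ^ 2 - E.d * hNum y₁ ^ 2 = 0) (h₂ : B * hDen y₁ + D * hNum y₁ = 0) :
    y₁ ≠ y₂ := by
  rintro rfl
  obtain ⟨k₁, k₂, k₃, k₄⟩ := h
  have hy := hNum_or_hDen y₁
  have ha := E.a_ne_zero
  have hd := E.d_ne_zero
  have had := E.a_ne_d
  have h2 := E.two_ne_zero
  generalize hNum y₁ = Y at *
  generalize hDen y₁ = T at *
  generalize hNum y₃ = Y₃ at *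
  generalize hDen y₃ = T₃ at *
  have hY : Y ≠ 0 := by
    rintro rfl
    simp [ha] at h₁ hy
    exact hy h₁
  -- the derivative of the cubic form with respect to `Y`, at the double root
  have key : 2 * E.d * A ^ 2 * Y * (Y + T) = 0 := by
    linear_combination (3 * Y ^ 2 * k₁ - 2 * Y * T * k₂ + T ^ 2 * k₃) + A ^ 2 * h₁
      + (B * T + D * Y + 2 * (Y - T) * D) * h₂
  have hYT : Y + T = 0 :=
    (mul_eq_zero.mp key).resolve_left (by simp [h2, hd, hA, hY])
  have : (E.a - E.d) * Y ^ 2 = 0 := by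
    rw [show T = -Y by linear_combination hYT] at h₁
    linear_combination h₁
  simp [sub_eq_zero, had, hY] at this

lemma IsFactorization.coeff_ne_zero {A B D c : K} {y₁ y₂ y₃ : OnePoint K}
    (h : IsFactorization E A B D c y₁ y₂ y₃) (hBD : B ≠ D) : c ≠ 0 := by
  rintro rfl
  have e := h.eval (L := K) (-1) 1
  simp only [Algebra.algebraMap_self, RingHom.id_apply] at e
  have : 2 * (B - D) ^ 2 = 0 := by linear_combination e
  simp [E.two_ne_zero, sub_eq_zero, hBD] at this

/-- Three roots of the cubic form give three points of the curve with sum zero. -/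
lemma IsFactorization.exists_points {A B D c : K} {y₁ y₂ y₃ : OnePoint K}
    (h : IsFactorization E A B D c y₁ y₂ y₃) (hA : A ≠ 0) (hBD : B ≠ D) :
    ∃ S₁ S₂ S₃ : E.Point, (S₁.y = y₁ ∧ S₂.y = y₂ ∧ S₃.y = y₃) ∧
      (S₁.x = graphX A B D y₁ ∧ S₂.x = graphX A B D y₂ ∧ S₃.x = graphX A B D y₃) ∧
      SumZero₃ S₁ S₂ S₃ := by
  have hpt : ∀ {y₁ y₂ y₃ : OnePoint K}, IsFactorization E A B D c y₁ y₂ y₃ →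
      E.Equation (hNum (graphX A B D y₁)) (hDen (graphX A B D y₁)) (hNum y₁) (hDen y₁) := by
    intro y₁ y₂ y₃ h
    obtain ⟨k, hk, h₁, h₂⟩ := exists_ofHom (graphX_defined hA hBD y₁)
    change _ = k * hNum (graphX A B D y₁) at h₁
    change _ = k * hDen (graphX A B D y₁) at h₂
    rw [Equation]
    apply mul_left_cancel₀ (pow_ne_zero 2 hk)
    have e := h.eval_root
    generalize hNum (graphX A B D y₁) = X at *
    generalize hDen (graphX A B D y₁) = Z at *
    generalize hNum y₁ = Y at *
    generalize hDen y₁ = T at *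
    linear_combination (T + Y) * e - (E.a * T ^ 2 - E.d * Y ^ 2) * (k * X + -A * (Y + T)) * h₁
      - (Y ^ 2 - T ^ 2) * (k * Z + (B * T + D * Y)) * h₂
  have hsum : ∀ {y₁ y₂ y₃ : OnePoint K} {S₁ S₂ S₃ : E.Point}, IsFactorization E A B D c y₁ y₂ y₃ →
      S₁.y = y₁ → S₂.y = y₂ → S₃.y = y₃ → S₁.x = graphX A B D y₁ → S₂.x = graphX A B D y₂ →
      S₃.x = graphX A B D y₃ → S₁.SumZero S₂ S₃ := by
    intro y₁ y₂ y₃ S₁ S₂ S₃ h a₁ a₂ a₃ b₁ b₂ b₃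
    obtain ⟨k, hk, h₁, h₁'⟩ := exists_ofHom (graphX_defined hA hBD y₁)
    obtain ⟨l, hl, h₂, h₂'⟩ := exists_ofHom (graphX_defined hA hBD y₂)
    obtain ⟨m, hm, h₃, h₃'⟩ := exists_ofHom (graphX_defined hA hBD y₃)
    have hklm : k * l * m ≠ 0 := by simp [hk, hl, hm]
    have hkl : k * l ≠ 0 := by simp [hk, hl]
    obtain ⟨r₁, r₂, r₃, r₄⟩ := cubic_relations (h.coeff_ne_zero hBD) h.1 h.2.1 h.2.2.1 h.2.2.2
    simp only [SumZero, sumX, sumY, sumZ, sumT, dualX, dualY, dualZ, dualT, a₁, a₂, a₃, b₁, b₂, b₃]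
    change _ = _ * hNum (graphX A B D _) at h₁ h₂ h₃
    change _ = _ * hDen (graphX A B D _) at h₁' h₂' h₃'
    rw [h₁, h₂, h₁', h₂'] at r₁ r₂ r₃ r₄
    rw [h₃, h₃'] at r₁ r₃
    refine ⟨?_, ?_, ?_, ?_⟩
    · apply mul_left_cancel₀ hklm
      linear_combination r₁
    · apply mul_left_cancel₀ hkl
      linear_combination r₂
    · apply mul_left_cancel₀ hklm
      linear_combination r₃
    · apply mul_left_cancel₀ hkl
      linear_combination r₄
  refine ⟨⟨_, _, hpt h⟩, ⟨_, _, hpt h.rotate⟩, ⟨_, _, hpt h.rotate.rotate⟩, ⟨rfl, rfl, rfl⟩,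
    ⟨rfl, rfl, rfl⟩, ?_, ?_, ?_⟩
  · exact hsum h rfl rfl rfl rfl rfl rfl
  · exact hsum h.rotate rfl rfl rfl rfl rfl rfl
  · exact hsum h.swap rfl rfl rfl rfl rfl rfl

lemma add_ne_zero_of_fibre {Q : E.Point} (h : hNum Q.x ≠ 0) : hNum Q.y + hDen Q.y ≠ 0 := by
  intro h'
  have e := Q.eqn_x
  have had := sub_ne_zero.mpr E.a_ne_d
  have hY : hNum Q.y = -hDen Q.y := by linear_combination h'
  rw [hY] at e
  have : (hNum Q.x ^ 2 * (E.a - E.d)) * hDen Q.y ^ 2 = 0 := by linear_combination e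
  have hT : hDen Q.y = 0 := by simpa [h, had] using this
  rw [hT, neg_zero] at hY
  exact (hNum_or_hDen Q.y).elim (fun h => h hY) fun h => h hT

lemma sub_ne_zero_of_fibre {Q : E.Point} (h : hNum Q.x ≠ 0) : hDen Q.y - hNum Q.y ≠ 0 := by
  intro h'
  have e := Q.eqn_x
  have had := sub_ne_zero.mpr E.a_ne_d
  have hY : hNum Q.y = hDen Q.y := by linear_combination -h'
  rw [hY] at e
  have : (hNum Q.x ^ 2 * (E.a - E.d)) * hDen Q.y ^ 2 = 0 := by linear_combination e
  have hT : hDen Q.y = 0 := by simpa [h, had] using this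
  rw [hT] at hY
  exact (hNum_or_hDen Q.y).elim (fun h => h hY) fun h => h hT

lemma fibre_ne_zero_of_den {Q : E.Point} (h : hDen Q.x ≠ 0) :
    E.a * hDen Q.y ^ 2 - E.d * hNum Q.y ^ 2 ≠ 0 := by
  intro hp
  have e := Q.eqn_x
  rw [hp, mul_zero, eq_comm] at e
  have e' := (mul_eq_zero.mp e).resolve_left (pow_ne_zero 2 h)
  exact (fibre_y_ne_zero E Q.y).elim (fun h => h hp) fun h => h e'

/-- Multiplication by the conjugate form `A (Y + T) Z - X (B T + D Y)` eliminates `X`. At a point of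
the conic that is not fixed by negation the conjugate form does not vanish, so that the elimination
does not change the order. -/
lemma exists_conicAt_mul {A B D : K} (hA : A ≠ 0) {Q : E.Point} (hQ : hNum Q.x * hDen Q.x ≠ 0)
    (hv : conicValue A B D Q = 0) : ∃ g, Q.HasOrderAt g 0 ∧ conicAt A B D Q * g =
      algebraMap K _ A ^ 2 * (numAt E.y Q.y + denAt E.y Q.y)
        * (algebraMap K _ E.a * denAt E.y Q.y ^ 2 - algebraMap K _ E.d * numAt E.y Q.y ^ 2)
      - (denAt E.y Q.y - numAt E.y Q.y)
        * (algebraMap K _ B * denAt E.y Q.y + algebraMap K _ D * numAt E.y Q.y) ^ 2 := by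
  have hx : hNum Q.x ≠ 0 := left_ne_zero_of_mul hQ
  have hz : hDen Q.x ≠ 0 := right_ne_zero_of_mul hQ
  have hyt := add_ne_zero_of_fibre hx
  have hconj : Q.HasValue (algebraMap K _ A * (numAt E.y Q.y + denAt E.y Q.y) * denAt E.x Q.x
      - numAt E.x Q.x * (algebraMap K _ B * denAt E.y Q.y + algebraMap K _ D * numAt E.y Q.y))
      (2 * (A * (hNum Q.y + hDen Q.y) * hDen Q.x)) := by
    have := (((Q.hasValue_algebraMap A).mul (Q.hasValue_numAt_y.add Q.hasValue_denAt_y)).mul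
      Q.hasValue_denAt_x).sub (Q.hasValue_numAt_x.mul (((Q.hasValue_algebraMap B).mul
      Q.hasValue_denAt_y).add ((Q.hasValue_algebraMap D).mul Q.hasValue_numAt_y)))
    convert this using 1
    rw [conicValue] at hv
    linear_combination hv
  have h₁ := (hconj.mul (((Q.hasValue_algebraMap E.a).mul (Q.hasValue_denAt_y.pow 2)).sub
    ((Q.hasValue_algebraMap E.d).mul (Q.hasValue_numAt_y.pow 2)))).hasOrderAt
    (mul_ne_zero (mul_ne_zero E.two_ne_zero (mul_ne_zero (mul_ne_zero hA hyt) hz))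
      (fibre_ne_zero_of_den hz))
  have h₂ := ((Q.hasValue_denAt_x.pow 2).mul (Q.hasValue_numAt_y.add
    Q.hasValue_denAt_y)).hasOrderAt (mul_ne_zero (pow_ne_zero 2 hz) hyt)
  refine ⟨_, h₁.div h₂, ?_⟩
  have hE := Q.equation_numAt_denAt
  have hne := h₂.ne_zero
  rw [mul_div_assoc', div_eq_iff hne, conicAt]
  generalize numAt E.y Q.y = Y at *
  generalize denAt E.y Q.y = T at *
  generalize numAt E.x Q.x = X at *
  generalize denAt E.x Q.x = Z at *
  linear_combination -(algebraMap K _ B * T + algebraMap K _ D * Y) ^ 2 * hE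

/-- At a point that is not fixed by negation the second coordinate is a local parameter, and the
order of the conic is the multiplicity of that coordinate as a root of the cubic form. -/
lemma hasOrderAt_conicAt_of_ne {A B D c : K} {y₁ y₂ y₃ : OnePoint K}
    (h : IsFactorization E A B D c y₁ y₂ y₃) (hA : A ≠ 0) (hBD : B ≠ D) {Q : E.Point}
    (hQ : hNum Q.x * hDen Q.x ≠ 0) (hv : conicValue A B D Q = 0) : open Classical in
    Q.HasOrderAt (conicAt A B D Q)
      ((if Q.y = y₁ then 1 else 0) + (if Q.y = y₂ then 1 else 0)
        + (if Q.y = y₃ then 1 else 0)) := by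
  obtain ⟨g, hg, e⟩ := exists_conicAt_mul hA hQ hv
  rw [← h.eval, ← eq_div_iff hg.ne_zero] at e
  rw [e]
  convert (((Q.hasValue_algebraMap c).hasOrderAt (h.coeff_ne_zero hBD)).mul
    (((Q.hasOrderAt_cross_y y₁).mul (Q.hasOrderAt_cross_y y₂)).mul
    (Q.hasOrderAt_cross_y y₃))).div hg using 1
  simp [hQ]

/-- At `O'` the irreducible conic is transversal to the curve. -/
lemma hasOrderAt_conicAt_O' {A B D : K} (hBD : B ≠ D) :
    O'.HasOrderAt (E := E) (conicAt A B D O') 1 := by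
  have ht : O'.IsUniformizerAt (E := E) E.x := by
    simpa [O'_x, O'_y] using (O' : E.Point).hasOrderAt_localCoord.1.1
  have hx := E.x_ne_zero
  have hy : O'.HasValue (E := E) E.y (-1) := O'.hasValue_numAt_y
  have h2 := E.two_ne_zero
  have hy1 := ((O'.hasValue_one (E := E)).sub hy)
  have hy1' : (1 : K) - -1 ≠ 0 := by norm_num; exact h2
  have hval := ((((hasValue_algebraMap O' A).mul ht.hasValue).mul
    (((hasValue_algebraMap O' E.a)).sub ((hasValue_algebraMap O' E.d).mul (hy.pow 2)))).mul
      (hy1.inv hy1')).add ((hasValue_algebraMap O' B).add ((hasValue_algebraMap O' D).mul hy))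
  refine ⟨E.x, _, ht, hval.isUnitAt ?_, ?_⟩
  · simpa [← sub_eq_add_neg, sub_eq_zero] using hBD
  · have hne := (hy1.isUnitAt hy1').1
    have hE := E.generic_equation
    simp only [conicAt, O'_x, O'_y, numAt_some, denAt_some]
    field_simp
    linear_combination -algebraMap K _ A * hE

/-- At a point with `x = ∞` the irreducible conic is transversal to the curve, if it passes through
the point at all. -/
lemma hasOrderAt_conicAt_infty {A B D : K} (hA : A ≠ 0) {Q : E.Point}
    (hQ : hDen Q.x = 0) (hv : B * hDen Q.y + D * hNum Q.y = 0) :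
    Q.HasOrderAt (conicAt A B D Q) 1 := by
  have hx : Q.x = OnePoint.infty := by
    cases hc : Q.x using OnePoint.rec <;> simp_all
  have ho := Q.hasOrderAt_denAt_x
  rw [if_pos hx] at ho
  have hT : hDen Q.y ≠ 0 := by
    have := Q.x_ne_infty_or_y_ne_infty.resolve_left (not_not.mpr hx)
    cases hc : Q.y using OnePoint.rec <;> simp_all
  have hc := Q.hasOrderAt_cross_y Q.y
  rw [if_pos rfl, if_pos (by rw [hQ, mul_zero])] at hc
  have hval := (((Q.hasValue_algebraMap A).mul (Q.hasValue_numAt_y.add Q.hasValue_denAt_y))).add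
    (Q.hasValue_numAt_x.mul ((Q.hasValue_algebraMap (D / hDen Q.y)).mul
      ((hc.div ho).hasValue_zero (by norm_num))))
  have hu := hval.isUnitAt (by
    simpa using ⟨hA, add_ne_zero_of_fibre (Q := Q) (by simp [hx])⟩)
  have hmul := ho.mul hu.hasOrderAt
  rw [add_zero] at hmul
  convert hmul using 1
  have hT' : algebraMap K E.FunctionField (hDen Q.y) ≠ 0 := by simpa using hT
  have hv' := congrArg (algebraMap K E.FunctionField) hv
  have hne := ho.ne_zero
  simp only [map_add, map_mul, map_zero] at hv'
  rw [conicAt, map_div₀]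
  field_simp
  linear_combination numAt E.x Q.x * denAt E.y Q.y * hv'

/-- A conic through `O'` and the nodes meets the curve, besides, in three points with sum zero. -/
theorem exists_divisor [IsAlgClosed K] (A B D : K) (h : ¬ (A = 0 ∧ B = 0 ∧ D = 0)) :
    ∃ S₁ S₂ S₃ : E.Point, SumZero₃ S₁ S₂ S₃ ∧ ∀ Q : E.Point, Q.HasOrderAt (conicAt A B D Q)
      ((S₁.toDivisor + S₂.toDivisor + S₃.toDivisor + O'.toDivisor : E.Point →₀ ℤ) Q) := by
  classical
  by_cases hA : A = 0
  · subst hA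
    exact exists_divisor_of_eq_zero (by simpa using h)
  by_cases hBD : B = D
  · subst hBD
    exact exists_divisor_of_eq (by simp [hA])
  obtain ⟨c, y₁, y₂, y₃, hf⟩ := exists_isFactorization E A B D
  obtain ⟨S₁, S₂, S₃, ⟨rfl, rfl, rfl⟩, ⟨b₁, b₂, b₃⟩, hsum⟩ := hf.exists_points hA hBD
  refine ⟨S₁, S₂, S₃, hsum, fun Q => ?_⟩
  have hiff : ∀ S : E.Point, S.x = graphX A B D S.y →
      (Q = S ↔ Q.y = S.y ∧ conicValue A B D Q = 0) := by
    intro S hS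
    rw [conicValue_eq_zero_iff hA hBD]
    constructor
    · rintro rfl
      exact ⟨rfl, hS⟩
    · rintro ⟨h₁, h₂⟩
      exact Point.ext (by rw [h₂, h₁, hS]) h₁
  simp only [Finsupp.add_apply, toDivisor_apply]
  by_cases hv : conicValue A B D Q = 0
  swap
  · have hQ : Q ≠ O' := by
      rintro rfl
      exact hv (conicValue_O' A B D)
    simpa [hiff S₁ b₁, hiff S₂ b₂, hiff S₃ b₃, hv, hQ] using
      (hasValue_conicAt A B D Q).hasOrderAt hv
  have hiff' : ∀ S : E.Point, S.x = graphX A B D S.y → (Q = S ↔ Q.y = S.y) := by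
    intro S hS
    rw [hiff S hS, and_iff_left hv]
  simp only [hiff' S₁ b₁, hiff' S₂ b₂, hiff' S₃ b₃]
  by_cases hx : hNum Q.x = 0
  · -- the only point with `x = 0` on the conic is `O'`, where the cubic form does not vanish
    have hx' : Q.x = OnePoint.some 0 := by cases hc : Q.x using OnePoint.rec <;> simp_all
    have hv' : hNum Q.y + hDen Q.y = 0 := by
      simpa [conicValue, hx', hA] using hv
    have hQ : Q = O' := by
      refine Point.ext hx' (eq_of_cross_eq ?_)
      simp [O'_y, hv']
    have hne : ∀ {y₁ y₂ y₃ : OnePoint K}, IsFactorization E A B D c y₁ y₂ y₃ → Q.y ≠ y₁ := by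
      rintro _ y₂ y₃ h rfl
      have e := h.eval_root
      rw [hQ, O'_y] at e
      have : 2 * (B - D) ^ 2 = 0 := by
        simp only [hNum_some, hDen_some] at e
        linear_combination -e
      simp [E.two_ne_zero, sub_eq_zero, hBD] at this
    rw [if_neg (hne hf), if_neg (hne hf.rotate), if_neg (hne hf.rotate.rotate), if_pos hQ, hQ]
    simpa using hasOrderAt_conicAt_O' hBD
  have hQ : Q ≠ O' := by
    rintro rfl
    simp [O'_x] at hx
  rw [if_neg hQ, add_zero]
  by_cases hz : hDen Q.x = 0
  swap
  · exact hasOrderAt_conicAt_of_ne hf hA hBD (mul_ne_zero hx hz) hv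
  have hv' : B * hDen Q.y + D * hNum Q.y = 0 := by
    simpa [conicValue, hz, hx] using hv
  have hp : E.a * hDen Q.y ^ 2 - E.d * hNum Q.y ^ 2 = 0 := by
    simpa [hz, hx] using Q.eqn_x
  have key : ∀ {y₁ y₂ y₃ : OnePoint K}, IsFactorization E A B D c y₁ y₂ y₃ → Q.y = y₁ →
      ((if Q.y = y₁ then 1 else 0) + (if Q.y = y₂ then 1 else 0) + (if Q.y = y₃ then 1 else 0) : ℤ)
        = 1 := by
    rintro y₁ y₂ y₃ h rfl
    rw [if_pos rfl, if_neg (h.ne_of_fibre_eq_zero hA hp hv'),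
      if_neg (h.swap.ne_of_fibre_eq_zero hA hp hv')]
    norm_num
  have hroot : Q.y = S₁.y ∨ Q.y = S₂.y ∨ Q.y = S₃.y := by
    have e := hf.eval (L := K) (hNum Q.y) (hDen Q.y)
    simp only [Algebra.algebraMap_self, RingHom.id_apply] at e
    rw [hp, hv'] at e
    have e' : c * ((hDen S₁.y * hNum Q.y - hNum S₁.y * hDen Q.y)
      * (hDen S₂.y * hNum Q.y - hNum S₂.y * hDen Q.y)
      * (hDen S₃.y * hNum Q.y - hNum S₃.y * hDen Q.y)) = 0 := by linear_combination e
    rw [mul_eq_zero, or_iff_right (hf.coeff_ne_zero hBD), mul_eq_zero, mul_eq_zero, or_assoc] at e'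
    exact e'.imp eq_of_cross_eq (Or.imp eq_of_cross_eq eq_of_cross_eq)
  convert hasOrderAt_conicAt_infty hA hz hv' using 1
  rcases hroot with h | h | h
  · exact key hf h
  · refine Eq.trans ?_ (key hf.rotate h)
    ring
  · refine Eq.trans ?_ (key hf.rotate.rotate h)
    ring

end ConicDivisor

end Point

/-! ### The residual intersection and uniqueness -/

namespace Point

section Residual

variable {K : Type*} [Field K] {E : TwistedEdwards K}

/-- If `R` and `P` are among three points with sum zero, the third one is `-(R + P)`. -/
lemma SumZero₃.exists_residual {R P S₁ S₂ S₃ : E.Point} (h : SumZero₃ S₁ S₂ S₃)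
    (hle : ∀ Q, (R.toDivisor + P.toDivisor : E.Point →₀ ℤ) Q
      ≤ (S₁.toDivisor + S₂.toDivisor + S₃.toDivisor : E.Point →₀ ℤ) Q) :
    ∃ S, R.SumZero P S ∧ (S₁.toDivisor + S₂.toDivisor + S₃.toDivisor : E.Point →₀ ℤ)
      = R.toDivisor + P.toDivisor + S.toDivisor := by
  classical
  obtain ⟨h₁, h₂, h₃⟩ := h
  have hR := hle R
  have hP := hle P
  simp only [Finsupp.add_apply, toDivisor_apply, if_true] at hR hP
  have : (R = S₁ ∧ P = S₂) ∨ (R = S₂ ∧ P = S₁) ∨ (R = S₁ ∧ P = S₃) ∨ (R = S₃ ∧ P = S₁) ∨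
      (R = S₂ ∧ P = S₃) ∨ (R = S₃ ∧ P = S₂) := by
    grind
  rcases this with ⟨rfl, rfl⟩ | ⟨rfl, rfl⟩ | ⟨rfl, rfl⟩ | ⟨rfl, rfl⟩ | ⟨rfl, rfl⟩ | ⟨rfl, rfl⟩
  · exact ⟨_, h₁, by abel⟩
  · exact ⟨_, h₁.symm, by abel⟩
  · exact ⟨_, h₃, by abel⟩
  · exact ⟨_, h₃.symm, by abel⟩
  · exact ⟨_, h₂, by abel⟩
  · exact ⟨_, h₂.symm, by abel⟩

/-- A conic through `R`, `P`, `O'` and the nodes meets the curve, besides, in `-(R + P)`. -/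
theorem hasOrderAt_conicAt [IsAlgClosed K] {A B D : K} (h : ¬ (A = 0 ∧ B = 0 ∧ D = 0))
    {R P : E.Point} (hle : ∀ (Q : E.Point) (m : ℤ), Q.HasOrderAt (conicAt A B D Q) m →
      (R.toDivisor + P.toDivisor + O'.toDivisor : E.Point →₀ ℤ) Q ≤ m) (Q : E.Point) :
    Q.HasOrderAt (conicAt A B D Q)
      ((R.toDivisor + P.toDivisor + (-(R + P)).toDivisor + O'.toDivisor : E.Point →₀ ℤ) Q) := by
  obtain ⟨S₁, S₂, S₃, hS, ho⟩ := exists_divisor (E := E) A B D h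
  obtain ⟨S, hRP, e⟩ := hS.exists_residual (R := R) (P := P) fun Q => by
    have := hle Q _ (ho Q)
    rw [Finsupp.add_apply, Finsupp.add_apply _ O'.toDivisor] at this
    linarith
  have := ho Q
  rwa [e, ← Point.neg_neg S, ← hRP.add_eq] at this

lemma exists_notMem_fibre_y [IsAlgClosed K] (s : Finset (OnePoint K)) : ∃ Q : E.Point, Q.y ∉ s := by
  have : Infinite K := IsAlgClosed.instInfinite
  have : Infinite (OnePoint K) := Infinite.of_injective _ OnePoint.coe_injective
  obtain ⟨c, hc⟩ := Infinite.exists_notMem_finset s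
  obtain ⟨Q, rfl⟩ := exists_y_eq E c
  exact ⟨Q, hc⟩

/-- Two conics through `R`, `P`, `O'` and the nodes are proportional: since they have the same
divisor, the combination of their equations that vanishes at one more point would otherwise be a
conic through the same points with a zero too many. -/
theorem exists_proportional [IsAlgClosed K] {A B D A' B' D' : K} (h : ¬ (A = 0 ∧ B = 0 ∧ D = 0))
    (h' : ¬ (A' = 0 ∧ B' = 0 ∧ D' = 0)) {R P : E.Point}
    (hle : ∀ (Q : E.Point) (m : ℤ), Q.HasOrderAt (conicAt A B D Q) m →
      (R.toDivisor + P.toDivisor + O'.toDivisor : E.Point →₀ ℤ) Q ≤ m)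
    (hle' : ∀ (Q : E.Point) (m : ℤ), Q.HasOrderAt (conicAt A' B' D' Q) m →
      (R.toDivisor + P.toDivisor + O'.toDivisor : E.Point →₀ ℤ) Q ≤ m) :
    ∃ l m : K, m ≠ 0 ∧ m * A' = l * A ∧ m * B' = l * B ∧ m * D' = l * D := by
  classical
  obtain ⟨T, hT⟩ := exists_notMem_fibre_y (E := E)
    {R.y, P.y, (-(R + P)).y, (O' : E.Point).y}
  simp only [Finset.mem_insert, Finset.mem_singleton, not_or] at hT
  obtain ⟨hT₁, hT₂, hT₃, hT₄⟩ := hT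
  have hT0 : (R.toDivisor + P.toDivisor + (-(R + P)).toDivisor + O'.toDivisor : E.Point →₀ ℤ) T
      = 0 := by
    have hne : ∀ {S : E.Point}, ¬ T.y = S.y → S.toDivisor T = 0 := by
      intro S hS
      rw [toDivisor_apply, if_neg]
      rintro rfl
      exact hS rfl
    simp only [Finsupp.add_apply, hne hT₁, hne hT₂, hne hT₃, hne hT₄, add_zero]
  have hval : ∀ {A B D : K}, ¬ (A = 0 ∧ B = 0 ∧ D = 0) →
      (∀ (Q : E.Point) (m : ℤ), Q.HasOrderAt (conicAt A B D Q) m →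
      (R.toDivisor + P.toDivisor + O'.toDivisor : E.Point →₀ ℤ) Q ≤ m) →
      conicValue A B D T ≠ 0 := by
    intro A B D h hle hv
    have ho := hasOrderAt_conicAt h hle T
    rw [hT0] at ho
    have hv' := hasValue_conicAt A B D T
    rw [hv] at hv'
    exact hv'.inv_notMem ho.ne_zero (ho.inv.mem (by norm_num))
  refine ⟨conicValue A' B' D' T, conicValue A B D T, hval h hle, ?_⟩
  have hl := hval h' hle'
  have hm := hval h hle
  generalize hlv : conicValue A' B' D' T = l at *
  generalize hmv : conicValue A B D T = m at *
  by_contra hc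
  have h'' : ¬ (l * A + -m * A' = 0 ∧ l * B + -m * B' = 0 ∧ l * D + -m * D' = 0) := by
    rintro ⟨h₁, h₂, h₃⟩
    exact hc ⟨by linear_combination -h₁, by linear_combination -h₂, by linear_combination -h₃⟩
  refine hval h'' (fun Q n hn => ?_) ?_
  · have o₁ := ((Q.hasValue_algebraMap l).hasOrderAt hl).mul (hasOrderAt_conicAt h hle Q)
    have o₂ := ((Q.hasValue_algebraMap (-m)).hasOrderAt (neg_ne_zero.mpr hm)).mul
      (hasOrderAt_conicAt h' hle' Q)
    refine o₁.add_le o₂ (m := n) ?_ ?_ ?_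
    · convert hn using 1
      simp only [conicAt, map_add, map_mul]
      ring
    · rw [zero_add]
      exact hle Q _ (hasOrderAt_conicAt h hle Q)
    · rw [zero_add]
      exact hle' Q _ (hasOrderAt_conicAt h' hle' Q)
  · rw [conicValue] at hlv hmv ⊢
    linear_combination l * hmv - m * hlv

end Residual

/-! ### Tangent conics -/

section Tangent

variable {K : Type*} [Field K] {E : TwistedEdwards K}

/-- The conic with the coefficients of the tangent at `S` (Arène, Lange, Naehrig and Ritzenthaler)
meets the curve doubly at `S`. -/
lemma two_le_of_tangent {S : E.Point} (hS : hNum S.x * hDen S.x ≠ 0) {A B D : K}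
    (hA : A = hNum S.x * hDen S.x * (hDen S.y - hNum S.y))
    (hB : B = hDen S.x ^ 2 * hNum S.y - E.a * hNum S.x ^ 2 * hDen S.y)
    (hD : D = E.d * hNum S.x ^ 2 * hNum S.y - hDen S.x ^ 2 * hDen S.y) {m : ℤ}
    (hm : S.HasOrderAt (conicAt A B D S) m) : 2 ≤ m := by
  have hA0 : A ≠ 0 := by
    rw [hA]
    exact mul_ne_zero hS (sub_ne_zero_of_fibre (left_ne_zero_of_mul hS))
  have hE := S.eqn
  rw [Equation] at hE
  have hv : conicValue A B D S = 0 := by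
    rw [conicValue, hA, hB, hD]
    linear_combination -hNum S.x * hE
  obtain ⟨g, hg, e⟩ := exists_conicAt_mul hA0 hS hv
  have hc := S.hasOrderAt_cross_y S.y
  rw [if_pos rfl, if_neg hS] at hc
  -- the cubic form has a double root at `S`, by the equation of the curve
  have e' : conicAt A B D S * g =
      (algebraMap K _ (hDen S.y) * numAt E.y S.y - algebraMap K _ (hNum S.y) * denAt E.y S.y) ^ 2
      * (algebraMap K _ (hDen S.x ^ 4 - 2 * E.d * hNum S.x ^ 2 * hDen S.x ^ 2
          + E.a * E.d * hNum S.x ^ 4) * numAt E.y S.y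
        + algebraMap K _ (2 * E.a * hNum S.x ^ 2 * hDen S.x ^ 2 - E.a * E.d * hNum S.x ^ 4
          - hDen S.x ^ 4) * denAt E.y S.y) := by
    have hE' := congrArg (algebraMap K E.FunctionField) hE
    rw [e, hA, hB, hD]
    simp only [map_add, map_sub, map_mul, map_pow, map_ofNat] at hE' ⊢
    generalize algebraMap K E.FunctionField (hNum S.x) = X₀ at *
    generalize algebraMap K E.FunctionField (hNum S.y) = Y₀ at *
    generalize algebraMap K E.FunctionField (hDen S.x) = Z₀ at *
    generalize algebraMap K E.FunctionField (hDen S.y) = T₀ at *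
    generalize numAt E.y S.y = Y at *
    generalize denAt E.y S.y = T at *
    linear_combination X₀ ^ 2 * (Y - T) * (algebraMap K _ E.a * T ^ 2 - algebraMap K _ E.d * Y ^ 2)
      * hE'
  have hmem := (((S.hasValue_algebraMap (hDen S.x ^ 4 - 2 * E.d * hNum S.x ^ 2 * hDen S.x ^ 2
    + E.a * E.d * hNum S.x ^ 4)).mul S.hasValue_numAt_y).add
    ((S.hasValue_algebraMap (2 * E.a * hNum S.x ^ 2 * hDen S.x ^ 2 - E.a * E.d * hNum S.x ^ 4
    - hDen S.x ^ 4)).mul S.hasValue_denAt_y)).mem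
  have h₁ := ((hm.mul hg).div (hc.pow 2)).nonneg (by
    rw [e', mul_div_cancel_left₀ _ (hc.pow 2).ne_zero]
    exact hmem)
  norm_num at h₁
  exact h₁

end Tangent

end Point

/-! ### Quadratic forms in three variables -/

section Forms

/-- The quadratic form `A (Z² + Y Z) + B X Z + D X Y`. -/
noncomputable def conicForm {F : Type*} [Field F] (A B D : F) : MvPolynomial (Fin 3) F :=
  MvPolynomial.C A * (MvPolynomial.X 2 ^ 2 + MvPolynomial.X 1 * MvPolynomial.X 2)
    + MvPolynomial.C B * (MvPolynomial.X 0 * MvPolynomial.X 2)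
    + MvPolynomial.C D * (MvPolynomial.X 0 * MvPolynomial.X 1)

lemma exists_eq_of_isHomogeneous_two {F : Type*} [Field F] {φ : MvPolynomial (Fin 3) F}
    (h : φ.IsHomogeneous 2) : ∃ c₀ c₁ c₂ c₃ c₄ c₅ : F,
    φ = MvPolynomial.C c₀ * MvPolynomial.X 0 ^ 2 + MvPolynomial.C c₁ * MvPolynomial.X 1 ^ 2
      + MvPolynomial.C c₂ * MvPolynomial.X 2 ^ 2
      + MvPolynomial.C c₃ * (MvPolynomial.X 0 * MvPolynomial.X 1)
      + MvPolynomial.C c₄ * (MvPolynomial.X 0 * MvPolynomial.X 2)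
      + MvPolynomial.C c₅ * (MvPolynomial.X 1 * MvPolynomial.X 2) := by
  classical
  refine ⟨φ.coeff (Finsupp.single 0 2), φ.coeff (Finsupp.single 1 2), φ.coeff (Finsupp.single 2 2),
    φ.coeff (Finsupp.single 0 1 + Finsupp.single 1 1),
    φ.coeff (Finsupp.single 0 1 + Finsupp.single 2 1),
    φ.coeff (Finsupp.single 1 1 + Finsupp.single 2 1), ?_⟩
  have hsq (c : F) (i : Fin 3) : MvPolynomial.C c * MvPolynomial.X i ^ 2
      = MvPolynomial.monomial (Finsupp.single i 2) c := by
    rw [MvPolynomial.C_mul_X_pow_eq_monomial]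
  have hmul (c : F) (i j : Fin 3) : MvPolynomial.C c * (MvPolynomial.X i * MvPolynomial.X j)
      = MvPolynomial.monomial (Finsupp.single i 1 + Finsupp.single j 1) c := by
    rw [MvPolynomial.X, MvPolynomial.X, MvPolynomial.monomial_mul, MvPolynomial.C_mul_monomial]
    simp
  simp only [hsq, hmul]
  ext m
  have hm : φ.coeff m ≠ 0 → m 0 + m 1 + m 2 = 2 := by
    intro hm
    have := h hm
    simpa [Finsupp.weight_apply, Finsupp.sum_fintype, Fin.sum_univ_three] using this
  have hext (s : Fin 3 →₀ ℕ) : s = m ↔ s 0 = m 0 ∧ s 1 = m 1 ∧ s 2 = m 2 := by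
    rw [Finsupp.ext_iff]
    simp [Fin.forall_fin_succ]
  have hcoeff (s : Fin 3 →₀ ℕ) : (MvPolynomial.monomial s (φ.coeff s)).coeff m
      = if s = m then φ.coeff m else 0 := by
    rw [MvPolynomial.coeff_monomial]
    split_ifs with h
    · rw [h]
    · rfl
  simp only [MvPolynomial.coeff_add, hcoeff, hext, Finsupp.add_apply, Finsupp.single_apply]
  by_cases h0 : φ.coeff m = 0
  · simp [h0]
  have h2 := hm h0
  clear hcoeff hext hm
  generalize φ.coeff m = c at *
  generalize m 0 = i at *
  generalize m 1 = j at *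
  generalize m 2 = k at *
  have hi : i ≤ 2 := by omega
  have hj : j ≤ 2 := by omega
  obtain rfl : k = 2 - i - j := by omega
  interval_cases i <;> interval_cases j <;> simp_all

lemma isHomogeneous_conicForm {F : Type*} [Field F] (A B D : F) :
    (conicForm A B D).IsHomogeneous 2 := by
  have hX (i : Fin 3) := MvPolynomial.isHomogeneous_X F i
  have h (c : F) {p : MvPolynomial (Fin 3) F} (hp : p.IsHomogeneous 2) :
      (MvPolynomial.C c * p).IsHomogeneous 2 := by
    simpa using (MvPolynomial.isHomogeneous_C (Fin 3) c).mul hp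
  exact ((h A (((hX 2).pow 2).add ((hX 1).mul (hX 2)))).add (h B ((hX 0).mul (hX 2)))).add
    (h D ((hX 0).mul (hX 1)))

lemma conicForm_zero {F : Type*} [Field F] : conicForm (0 : F) 0 0 = 0 := by simp [conicForm]

lemma eq_zero_of_conicForm_eq_zero {F : Type*} [Field F] {A B D : F} (h : conicForm A B D = 0) :
    A = 0 ∧ B = 0 ∧ D = 0 := by
  have h₁ := congrArg (MvPolynomial.eval ![0, 0, 1]) h
  have h₂ := congrArg (MvPolynomial.eval ![1, 0, 1]) h
  have h₃ := congrArg (MvPolynomial.eval ![1, 1, 0]) h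
  simp [conicForm] at h₁ h₂ h₃
  simp_all

end Forms

/-! ### The forms of conics through the nodes -/

section ConicForms

variable {F : Type*} [Field F] {E : TwistedEdwards F} {K : Type*} [Field K] [Algebra F K]

lemma aeval_conicForm {L : Type*} [Field L] [Algebra K L] (A B D : F) (v : Fin 3 → L) :
    MvPolynomial.aeval v (MvPolynomial.map (algebraMap F K) (conicForm A B D))
      = algebraMap K L (algebraMap F K A) * (v 2 ^ 2 + v 1 * v 2)
        + algebraMap K L (algebraMap F K B) * (v 0 * v 2)
        + algebraMap K L (algebraMap F K D) * (v 0 * v 1) := by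
  simp [conicForm]

open Point in
/-- In the plane coordinates at `Q` the form `conicForm A B D` is `conicAt` times `Z T`. The factor
`Z T` is the contribution of the nodes. -/
lemma aeval_planeCoords (A B D : F) (Q : (E.baseChange K).Point) :
    MvPolynomial.aeval Q.planeCoords (MvPolynomial.map (algebraMap F K) (conicForm A B D))
      = conicAt (algebraMap F K A) (algebraMap F K B) (algebraMap F K D) Q
        * (denAt (E.baseChange K).x Q.x * denAt (E.baseChange K).y Q.y) := by
  have hx := (E.baseChange K).x_ne_zero
  have hy := (E.baseChange K).y_ne_zero
  have hQ := Q.x_ne_infty_or_y_ne_infty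
  rw [aeval_conicForm]
  simp only [conicAt, planeCoords]
  cases h₁ : Q.x using OnePoint.rec <;> cases h₂ : Q.y using OnePoint.rec
  · simp [h₁, h₂] at hQ
  all_goals
    simp
    field_simp
    ring

open Point in
lemma formFunction_conicForm (A B D : F) (Q : (E.baseChange K).Point) :
    formFunction K E (conicForm A B D)
      = conicAt (algebraMap F K A) (algebraMap F K B) (algebraMap F K D) Q
        / (denAt (E.baseChange K).x Q.x * denAt (E.baseChange K).y Q.y) := by
  have hx := (E.baseChange K).x_ne_zero
  have hy := (E.baseChange K).y_ne_zero
  rw [formFunction, aeval_conicForm]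
  simp only [conicAt]
  cases h₁ : Q.x using OnePoint.rec <;> cases h₂ : Q.y using OnePoint.rec <;>
  · simp
    field_simp
    ring

open Point in
lemma hasOrderAt_denAt {E : TwistedEdwards K} (Q : E.Point) :
    Q.HasOrderAt (denAt E.x Q.x * denAt E.y Q.y) Q.atInfinity := by
  classical
  have h := Q.hasOrderAt_denAt_x.mul Q.hasOrderAt_denAt_y
  convert h using 1
  have hQ := Q.x_ne_infty_or_y_ne_infty
  rw [atInfinity]
  by_cases h₁ : Q.x = OnePoint.infty <;> by_cases h₂ : Q.y = OnePoint.infty <;> simp_all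

/-- A form with a conic through `R`, `P`, `O'` and the nodes has no monomial `X²` or `Y²`, because
of the nodes, and the coefficients of `Z²` and `Y Z` agree, because of `O'`. -/
lemma IsConicThrough.exists_eq [IsAlgClosed K] {φ : MvPolynomial (Fin 3) F} {R P : E.Point}
    (h : IsConicThrough K φ R P) : ∃ A B D : F, ¬ (A = 0 ∧ B = 0 ∧ D = 0) ∧ φ = conicForm A B D ∧
      ∀ (Q : (E.baseChange K).Point) (m : ℤ),
        Q.HasOrderAt (Point.conicAt (algebraMap F K A) (algebraMap F K B) (algebraMap F K D) Q) m →
        ((R.baseChange K).toDivisor + (P.baseChange K).toDivisor + Point.O'.toDivisor :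
          (E.baseChange K).Point →₀ ℤ) Q ≤ m := by
  classical
  obtain ⟨h0, hh, hm⟩ := h
  obtain ⟨c₀, c₁, c₂, c₃, c₄, c₅, e⟩ := exists_eq_of_isHomogeneous_two hh
  have heval (Q : (E.baseChange K).Point) : MvPolynomial.aeval Q.planeCoords
      (MvPolynomial.map (algebraMap F K) φ) =
      algebraMap K _ (algebraMap F K c₀) * Q.planeCoords 0 ^ 2
      + algebraMap K _ (algebraMap F K c₁) * Q.planeCoords 1 ^ 2
      + algebraMap K _ (algebraMap F K c₂) * Q.planeCoords 2 ^ 2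
      + algebraMap K _ (algebraMap F K c₃) * (Q.planeCoords 0 * Q.planeCoords 1)
      + algebraMap K _ (algebraMap F K c₄) * (Q.planeCoords 0 * Q.planeCoords 2)
      + algebraMap K _ (algebraMap F K c₅) * (Q.planeCoords 1 * Q.planeCoords 2) := by
    rw [e]
    simp
  -- the value of `φ` at the image of `Q` in the plane
  have hvalue (Q : (E.baseChange K).Point) {X Y Z : K} (hX : Q.HasValue (Q.planeCoords 0) X)
      (hY : Q.HasValue (Q.planeCoords 1) Y) (hZ : Q.HasValue (Q.planeCoords 2) Z)
      (hpos : 0 < ((R.baseChange K).toDivisor + (P.baseChange K).toDivisor + Point.O'.toDivisor :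
        (E.baseChange K).Point →₀ ℤ) Q + Q.atInfinity) :
      algebraMap F K c₀ * X ^ 2 + algebraMap F K c₁ * Y ^ 2 + algebraMap F K c₂ * Z ^ 2
        + algebraMap F K c₃ * (X * Y) + algebraMap F K c₄ * (X * Z) + algebraMap F K c₅ * (Y * Z)
        = 0 := by
    obtain ⟨m, hle, ho⟩ := hm Q
    have hv := (((((Q.hasValue_algebraMap (algebraMap F K c₀)).mul (hX.pow 2)).add
      ((Q.hasValue_algebraMap (algebraMap F K c₁)).mul (hY.pow 2))).add
      ((Q.hasValue_algebraMap (algebraMap F K c₂)).mul (hZ.pow 2))).add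
      ((Q.hasValue_algebraMap (algebraMap F K c₃)).mul (hX.mul hY))).add
      ((Q.hasValue_algebraMap (algebraMap F K c₄)).mul (hX.mul hZ)) |>.add
      ((Q.hasValue_algebraMap (algebraMap F K c₅)).mul (hY.mul hZ))
    rw [← heval] at hv
    exact hv.unique (ho.hasValue_zero (by omega))
  have hnn (Q : (E.baseChange K).Point) : 0 ≤ ((R.baseChange K).toDivisor
      + (P.baseChange K).toDivisor : (E.baseChange K).Point →₀ ℤ) Q :=
    add_nonneg (Point.toDivisor_nonneg _ Q) (Point.toDivisor_nonneg _ Q)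
  have hc₀ : c₀ = 0 := by
    obtain ⟨Q, hQ⟩ := Point.exists_x_eq (E.baseChange K) OnePoint.infty
    have hQy := Q.x_ne_infty_or_y_ne_infty.resolve_left (not_not.mpr hQ)
    have vx := Q.hasValue_denAt_x
    have vy := Q.hasValue_numAt_y
    rw [hQ] at vx
    obtain ⟨y, hy⟩ : ∃ y : K, Q.y = OnePoint.some y := by
      cases hc : Q.y using OnePoint.rec <;> simp_all
    rw [hy] at vy
    have hp : Q.planeCoords = ![1, (E.baseChange K).y / (E.baseChange K).x,
        (E.baseChange K).x⁻¹] := by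
      rw [Point.planeCoords, hQ]
    have := hvalue Q (X := 1) (Y := y * 0) (Z := 0) (by rw [hp]; exact Q.hasValue_one)
      (by rw [hp]; exact vy.mul vx) (by rw [hp]; exact vx) (by
        have := hnn Q
        have := Point.toDivisor_nonneg Point.O' Q
        rw [Finsupp.add_apply, Point.atInfinity, if_pos (Or.inl hQ)]
        omega)
    simpa using this
  have hc₁ : c₁ = 0 := by
    obtain ⟨Q, hQ⟩ := Point.exists_y_eq (E.baseChange K) OnePoint.infty
    have vx := Q.hasValue_numAt_x
    have vy := Q.hasValue_denAt_y
    rw [hQ] at vy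
    have hQx := Q.x_ne_infty_or_y_ne_infty.resolve_right (not_not.mpr hQ)
    obtain ⟨x, hx⟩ : ∃ x : K, Q.x = OnePoint.some x := by
      cases hc : Q.x using OnePoint.rec <;> simp_all
    rw [hx] at vx
    have hp : Q.planeCoords = ![(E.baseChange K).x / (E.baseChange K).y, 1,
        (E.baseChange K).y⁻¹] := by
      rw [Point.planeCoords, hQ, hx]
    have := hvalue Q (X := x * 0) (Y := 1) (Z := 0) (by rw [hp]; exact vx.mul vy)
      (by rw [hp]; exact Q.hasValue_one) (by rw [hp]; exact vy) (by
        have := hnn Q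
        have := Point.toDivisor_nonneg Point.O' Q
        rw [Finsupp.add_apply, Point.atInfinity, if_pos (Or.inr hQ)]
        omega)
    simpa using this
  have hc₅ : c₂ - c₅ = 0 := by
    have := hvalue Point.O' (X := 0) (Y := -1) (Z := 1) (Point.hasValue_numAt_x Point.O')
      (Point.hasValue_numAt_y Point.O') (Point.hasValue_one _) (by
        have := hnn Point.O'
        rw [Finsupp.add_apply, Point.toDivisor_apply (Point.O'), if_pos rfl, Point.atInfinity]
        split_ifs <;> omega)
    apply (algebraMap F K).injective
    rw [hc₀, hc₁] at this
    rw [map_sub, map_zero]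
    simpa [← sub_eq_add_neg] using this
  have he : φ = conicForm c₂ c₄ c₃ := by
    rw [e, hc₀, hc₁, ← sub_eq_zero.mp hc₅, conicForm, MvPolynomial.C_0]
    ring
  refine ⟨c₂, c₄, c₃, ?_, he, fun Q m ho => ?_⟩
  · rintro ⟨rfl, rfl, rfl⟩
    exact h0 (he.trans conicForm_zero)
  · obtain ⟨n, hn, ho'⟩ := hm Q
    rw [he, aeval_planeCoords] at ho'
    have := (ho.mul (hasOrderAt_denAt Q)).unique Q ho'
    omega

lemma isConicThrough_conicForm [IsAlgClosed K] {A B D : F} (h : ¬ (A = 0 ∧ B = 0 ∧ D = 0))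
    {R P : E.Point} (hle : ∀ (Q : (E.baseChange K).Point) (m : ℤ),
      Q.HasOrderAt (Point.conicAt (algebraMap F K A) (algebraMap F K B) (algebraMap F K D) Q) m →
      ((R.baseChange K).toDivisor + (P.baseChange K).toDivisor + Point.O'.toDivisor :
        (E.baseChange K).Point →₀ ℤ) Q ≤ m) : IsConicThrough K (conicForm A B D) R P := by
  refine ⟨fun h0 => h (eq_zero_of_conicForm_eq_zero h0), isHomogeneous_conicForm A B D, fun Q => ?_⟩
  obtain ⟨S₁, S₂, S₃, -, ho⟩ := Point.exists_divisor (E := E.baseChange K) (algebraMap F K A)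
    (algebraMap F K B) (algebraMap F K D) (by simpa using h)
  refine ⟨_, ?_, by rw [aeval_planeCoords]; exact (ho Q).mul (hasOrderAt_denAt Q)⟩
  have := hle Q _ (ho Q)
  omega

end ConicForms

/-! ### Existence over the base field -/

section Existence

variable {F : Type*} [Field F] {E : TwistedEdwards F} {K : Type*} [Field K] [Algebra F K]

lemma IsConicThrough.symm {φ : MvPolynomial (Fin 3) F} {R P : E.Point}
    (h : IsConicThrough K φ R P) : IsConicThrough K φ P R := by
  obtain ⟨h₁, h₂, h₃⟩ := h
  refine ⟨h₁, h₂, fun Q => ?_⟩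
  rw [add_comm (P.baseChange K).toDivisor]
  exact h₃ Q

lemma Point.conicValue_baseChange (A B D : F) (R : E.Point) :
    conicValue (algebraMap F K A) (algebraMap F K B) (algebraMap F K D) (R.baseChange K) =
      algebraMap F K (conicValue A B D R) := by
  simp only [conicValue, hNum_baseChange_x, hDen_baseChange_x, hNum_baseChange_y,
    hDen_baseChange_y, map_add, map_mul]

/-- If one of the points is `O'`, the tangent at `O'` and the line `x = x(R)` form a conic as
required. -/
lemma exists_isConicThrough_O' [IsAlgClosed K] (R : E.Point) :
    ∃ φ, IsConicThrough K φ R Point.O' := by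
  have hR := hNum_or_hDen R.x
  refine ⟨conicForm (-hNum R.x) (hDen R.x) (hDen R.x), isConicThrough_conicForm (fun h => ?_)
    fun Q m hm => ?_⟩
  · exact hR.elim (fun h' => h' (neg_eq_zero.mp h.1)) fun h' => h' h.2.1
  · have o := (Q.hasOrderAt_fibre_x (R.baseChange K)).mul (Q.hasOrderAt_fibre_y Point.O')
    have e := hm.unique Q (n := _) (by
      convert o using 1
      simp only [Point.conicAt, Point.hNum_baseChange_x, Point.hDen_baseChange_x, Point.O'_y,
        hNum_some, hDen_some, map_neg, map_one]
      ring)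
    have hf : -(Point.O' : (E.baseChange K).Point) = Point.O' :=
      Point.ext (by simp [Point.neg_x, Point.O'_x]) rfl
    rw [e, Point.baseChange_O', hf]
    simp only [Finsupp.add_apply]
    have := Point.toDivisor_nonneg (R.baseChange K).flip Q
    omega

/-- If the two points coincide, the conic is tangent to the curve. At a point `R` that is fixed by
negation it consists of the lines `x = 0` and `y = y(R)`. -/
lemma exists_isConicThrough_self [IsAlgClosed K] {R : E.Point} (hRO : R ≠ Point.O') :
    ∃ φ, IsConicThrough K φ R R := by
  classical
  by_cases hR : hNum R.x * hDen R.x = 0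
  · have hy := hNum_or_hDen R.y
    refine ⟨conicForm 0 (-hNum R.y) (hDen R.y), isConicThrough_conicForm (fun h => ?_)
      fun Q m hm => ?_⟩
    · exact hy.elim (fun h' => h' (neg_eq_zero.mp h.2.1)) fun h' => h' h.2.2
    · have o := (Q.hasOrderAt_fibre_x 0).mul (Q.hasOrderAt_fibre_y (R.baseChange K))
      have e := hm.unique Q (n := _) (by
        convert o using 1
        simp only [Point.conicAt, Point.hNum_baseChange_y, Point.hDen_baseChange_y, Point.zero_x,
          hNum_some, hDen_some, map_neg, map_zero, map_one]
        ring)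
      have hf : (0 : (E.baseChange K).Point).flip = Point.O' :=
        Point.ext rfl (by simp [Point.flip_y, Point.zero_y, Point.O'_y])
      have hneg : -R = R := by
        refine Point.ext ?_ rfl
        rw [Point.neg_x]
        cases hc : R.x using OnePoint.rec <;> simp_all
      rw [e, hf, ← Point.baseChange_neg, hneg]
      simp only [Finsupp.add_apply]
      have := Point.toDivisor_nonneg (0 : (E.baseChange K).Point) Q
      omega
  · have hx : hNum R.x ≠ 0 := left_ne_zero_of_mul hR
    have hA := mul_ne_zero hR (Point.sub_ne_zero_of_fibre hx)
    refine ⟨conicForm (hNum R.x * hDen R.x * (hDen R.y - hNum R.y))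
      (hDen R.x ^ 2 * hNum R.y - E.a * hNum R.x ^ 2 * hDen R.y)
      (E.d * hNum R.x ^ 2 * hNum R.y - hDen R.x ^ 2 * hDen R.y),
      isConicThrough_conicForm (fun h => hA h.1) fun Q m hm => ?_⟩
    have hR' : R.baseChange K ≠ Point.O' := by
      rw [← Point.baseChange_O']
      exact (Point.baseChange_injective K).ne hRO
    by_cases h₁ : Q = R.baseChange K
    · subst h₁
      have := Point.two_le_of_tangent (S := R.baseChange K)
        (by rw [Point.hNum_baseChange_x, Point.hDen_baseChange_x, ← map_mul]; simpa using hR)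
        (by rw [Point.hNum_baseChange_x, Point.hDen_baseChange_x, Point.hNum_baseChange_y,
          Point.hDen_baseChange_y, ← map_sub, ← map_mul, ← map_mul])
        (by rw [Point.hNum_baseChange_x, Point.hDen_baseChange_x, Point.hNum_baseChange_y,
          Point.hDen_baseChange_y, map_sub, map_mul, map_mul, map_mul, map_pow, map_pow]; rfl)
        (by rw [Point.hNum_baseChange_x, Point.hDen_baseChange_x, Point.hNum_baseChange_y,
          Point.hDen_baseChange_y, map_sub, map_mul, map_mul, map_mul, map_pow, map_pow]; rfl) hm
      simpa [Point.toDivisor_apply, hR'] using this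
    · have hnn := hm.nonneg (Point.hasValue_conicAt _ _ _ Q).mem
      by_cases h₂ : Q = Point.O'
      · subst h₂
        have hv := Point.hasValue_conicAt (E := E.baseChange K)
          (algebraMap F K (hNum R.x * hDen R.x * (hDen R.y - hNum R.y)))
          (algebraMap F K (hDen R.x ^ 2 * hNum R.y - E.a * hNum R.x ^ 2 * hDen R.y))
          (algebraMap F K (E.d * hNum R.x ^ 2 * hNum R.y - hDen R.x ^ 2 * hDen R.y)) Point.O'
        rw [Point.conicValue_O'] at hv
        simpa [Point.toDivisor_apply, hR'.symm, hR'] using hv.one_le hm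
      · simpa [Point.toDivisor_apply, h₁, h₂] using hnn

/-- If `R`, `P` and `O'` are distinct, the conic is found by solving two linear equations. -/
lemma exists_isConicThrough_of_ne [IsAlgClosed K] {R P : E.Point} (hRP : R ≠ P)
    (hR : R ≠ Point.O') (hP : P ≠ Point.O') : ∃ φ, IsConicThrough K φ R P := by
  classical
  let M : Matrix (Fin 3) (Fin 3) F := ![![(hNum R.y + hDen R.y) * hDen R.x, hNum R.x * hDen R.y,
    hNum R.x * hNum R.y], ![(hNum P.y + hDen P.y) * hDen P.x, hNum P.x * hDen P.y,
    hNum P.x * hNum P.y], 0]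
  obtain ⟨v, hv0, hv⟩ := Matrix.exists_mulVec_eq_zero_iff.mpr
    (Matrix.det_eq_zero_of_row_eq_zero (A := M) 2 fun j => rfl)
  have e₁ := congrFun hv 0
  have e₂ := congrFun hv 1
  simp [M, Matrix.mulVec, dotProduct, Fin.sum_univ_three] at e₁ e₂
  refine ⟨conicForm (v 0) (v 1) (v 2), isConicThrough_conicForm (fun h => hv0 ?_)
    fun Q m hm => ?_⟩
  · funext i
    fin_cases i
    exacts [h.1, h.2.1, h.2.2]
  have hinj := Point.baseChange_injective (E := E) K
  have h₁ := hinj.ne hRP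
  have h₂ := hinj.ne hR
  have h₃ := hinj.ne hP
  rw [Point.baseChange_O'] at h₂ h₃
  have hv := Point.hasValue_conicAt (algebraMap F K (v 0)) (algebraMap F K (v 1))
    (algebraMap F K (v 2)) Q
  rw [Finsupp.add_apply, Finsupp.add_apply, Point.toDivisor_apply, Point.toDivisor_apply,
    Point.toDivisor_apply]
  by_cases hQR : Q = R.baseChange K
  · subst hQR
    rw [Point.conicValue_baseChange, show Point.conicValue (v 0) (v 1) (v 2) R = 0 by
      rw [Point.conicValue]; linear_combination e₁, map_zero] at hv
    simpa [h₁, h₂, h₁.symm, h₂.symm] using hv.one_le hm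
  by_cases hQP : Q = P.baseChange K
  · subst hQP
    rw [Point.conicValue_baseChange, show Point.conicValue (v 0) (v 1) (v 2) P = 0 by
      rw [Point.conicValue]; linear_combination e₂, map_zero] at hv
    simpa [h₁, h₃, h₁.symm, h₃.symm] using hv.one_le hm
  by_cases hQO : Q = Point.O'
  · subst hQO
    rw [Point.conicValue_O'] at hv
    simpa [hQR, hQP] using hv.one_le hm
  · simpa [hQR, hQP, hQO] using hm.nonneg hv.mem

/-- Coefficient vectors over `F` that are proportional over `K` are proportional over `F`. -/
lemma exists_conicForm_eq_mul {A B D A' B' D' : F} (h : ¬ (A = 0 ∧ B = 0 ∧ D = 0))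
    (h' : ¬ (A' = 0 ∧ B' = 0 ∧ D' = 0)) {l m : K} (hm : m ≠ 0)
    (eA : m * algebraMap F K A' = l * algebraMap F K A)
    (eB : m * algebraMap F K B' = l * algebraMap F K B)
    (eD : m * algebraMap F K D' = l * algebraMap F K D) :
    ∃ c : F, c ≠ 0 ∧ conicForm A' B' D' = MvPolynomial.C c * conicForm A B D := by
  -- The ratio `l / m` lies in `F`, since one of `A`, `B` and `D` is invertible there.
  obtain ⟨c, hc⟩ : ∃ c : F, l = m * algebraMap F K c := by
    have key : ∀ {s s' : F}, s ≠ 0 → m * algebraMap F K s' = l * algebraMap F K s →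
        ∃ c : F, l = m * algebraMap F K c := by
      intro s s' hs e
      refine ⟨s' / s, ?_⟩
      have hs' : algebraMap F K s ≠ 0 := by simpa using hs
      rw [map_div₀]
      field_simp
      exact e.symm
    by_cases hA : A = 0
    · by_cases hB : B = 0
      · exact key (fun hD => h ⟨hA, hB, hD⟩) eD
      · exact key hB eB
    · exact key hA eA
  have key : ∀ {s s' : F}, m * algebraMap F K s' = l * algebraMap F K s → s' = c * s := by
    intro s s' e
    apply (algebraMap F K).injective
    rw [map_mul]
    exact mul_left_cancel₀ hm (by rw [e, hc, mul_assoc])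
  obtain rfl := key eA
  obtain rfl := key eB
  obtain rfl := key eD
  refine ⟨c, ?_, ?_⟩
  · rintro rfl
    simp at h'
  · simp only [conicForm, map_mul]
    ring

end Existence

end TwistedEdwards

theorem lemma1 {F : Type*} [Field F] (E : TwistedEdwards F) (K : Type*) [Field K] [Algebra F K]
    [IsAlgClosed K] (R P : E.Point) :
    (∃ φ : MvPolynomial (Fin 3) F, TwistedEdwards.IsConicThrough K φ R P) ∧
    (∀ φ φ' : MvPolynomial (Fin 3) F, TwistedEdwards.IsConicThrough K φ R P →
      TwistedEdwards.IsConicThrough K φ' R P →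
        ∃ c : F, c ≠ 0 ∧ φ' = MvPolynomial.C c * φ) ∧
    (∀ φ : MvPolynomial (Fin 3) F, TwistedEdwards.IsConicThrough K φ R P →
      ∀ Q : (E.baseChange K).Point, Q.HasOrderAt (TwistedEdwards.formFunction K E φ)
        (((R.baseChange K).toDivisor + (P.baseChange K).toDivisor
          + ((-(R + P)).baseChange K).toDivisor + TwistedEdwards.Point.O'.toDivisor :
            (E.baseChange K).Point →₀ ℤ) Q - Q.atInfinity)) ∧
    (∀ φ ψ : MvPolynomial (Fin 3) F, TwistedEdwards.IsConicThrough K φ R P →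
      TwistedEdwards.IsConicThrough K ψ (R + P) (-(R + P)) →
        TwistedEdwards.IsMillerFunction K
          (TwistedEdwards.formFunction K E φ / TwistedEdwards.formFunction K E ψ) R P) := by
  have hdiv : ∀ (R P : E.Point) (φ : MvPolynomial (Fin 3) F),
      TwistedEdwards.IsConicThrough K φ R P → ∀ Q : (E.baseChange K).Point,
      Q.HasOrderAt (TwistedEdwards.formFunction K E φ)
        (((R.baseChange K).toDivisor + (P.baseChange K).toDivisor
          + ((-(R + P)).baseChange K).toDivisor + TwistedEdwards.Point.O'.toDivisor :
            (E.baseChange K).Point →₀ ℤ) Q - Q.atInfinity) := by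
    intro R P φ h Q
    obtain ⟨A, B, D, h0, rfl, hle⟩ := h.exists_eq
    rw [TwistedEdwards.formFunction_conicForm A B D Q, TwistedEdwards.Point.baseChange_neg,
      TwistedEdwards.Point.baseChange_add]
    exact (TwistedEdwards.Point.hasOrderAt_conicAt (by simpa using h0) hle Q).div
      (TwistedEdwards.hasOrderAt_denAt Q)
  refine ⟨?_, ?_, hdiv R P, ?_⟩
  · by_cases hP : P = TwistedEdwards.Point.O'
    · subst hP
      exact TwistedEdwards.exists_isConicThrough_O' R
    by_cases hR : R = TwistedEdwards.Point.O'
    · subst hR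
      obtain ⟨φ, hφ⟩ := TwistedEdwards.exists_isConicThrough_O' (K := K) P
      exact ⟨φ, hφ.symm⟩
    by_cases hRP : R = P
    · subst hRP
      exact TwistedEdwards.exists_isConicThrough_self hR
    · exact TwistedEdwards.exists_isConicThrough_of_ne hRP hR hP
  · intro φ φ' h h'
    obtain ⟨A, B, D, h0, rfl, hle⟩ := h.exists_eq
    obtain ⟨A', B', D', h0', rfl, hle'⟩ := h'.exists_eq
    obtain ⟨l, m, hm, e₁, e₂, e₃⟩ := TwistedEdwards.Point.exists_proportional
      (by simpa using h0) (by simpa using h0') hle hle'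
    exact TwistedEdwards.exists_conicForm_eq_mul h0 h0' hm e₁ e₂ e₃
  · intro φ ψ hφ hψ Q
    -- the divisor of the denominator contains `-[(R + P) - (R + P)] = O`
    have h := (hdiv _ _ φ hφ Q).div (hdiv _ _ ψ hψ Q)
    rw [TwistedEdwards.Point.add_neg_self, TwistedEdwards.Point.neg_zero,
      TwistedEdwards.Point.baseChange_zero] at h
    convert h using 1
    simp only [Finsupp.add_apply, Finsupp.sub_apply]
    ring
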